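/- For a monoid $M$ and $U\subseteq M$ write $\langle U\rangle$ for the submonoid generated by $U$. The rank $\operatorname{rank}(M)$ is the minimal cardinality of a subset $U\subseteq M$ with $\langle U\rangle=M$; if $M$ is generated by its idempotents, the idempotent rank $\operatorname{idrank}(M)$ is the minimal cardinality of a set $U$ of idempotents of $M$ with $\langle U\rangle=M$. Let $X$ be a finite set with $|X|=n$, and let $\mathcal P$ be a partition of $X$ into non-empty blocks, not all of the same size. Let $\mathcal T(X,\mathcal P)$ be the monoid (under composition) of all maps $f:X\to X$ such that for every block $C$ of $\mathcal P$ there is a block $D$ of $\mathcal P$ with $f(C)\subseteq D$, and let $S=\mathcal E(X,\mathcal P)$ be the submonoid of $\mathcal T(X,\mathcal P)$ generated by all idempotents of $\mathcal T(X,\mathcal P)$. For $1\le i\le n$ let $\mu_i$ be the number of blocks of $\mathcal P$ of size $i$, let $\nu_i$ be the number of $j\in\{1,\dots,i-1\}$ with $\mu_j\neq0$, and let $\rho_2=2$ and $\rho_i=\binom i2$ for $i\ne2$. Put $$\rho=\sum_{i=1}^n\left(\mu_i\rho_i+i!\binom{\mu_i}2+\mu_i\nu_i\right)+\sum_{1\le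 i<j\le n}\mu_i\mu_j\frac{j!}{(j-i)!},$$ where $\binom ab=0$ if $a<b$. Then $\operatorname{rank}(S)=\rho$. Moreover, $\operatorname{idrank}(S)=\rho$ if $\mu_1\neq2$, and $\operatorname{idrank}(S)=\rho+1$ if $\mu_1=2$. -/

import Mathlib

open scoped Nat

/-- The rank of a monoid: the minimal cardinality of a subset generating `M` as a monoid.
It is `⊤` if `M` is not finitely generated. -/
noncomputable def monoidRank (M : Type*) [Monoid M] : ℕ∞ :=
  ⨅ U ∈ {U : Set M | Submonoid.closure U = ⊤}, U.encard

/-- The idempotent rank of a monoid: the minimal cardinality of a set of idempotents generating `M`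
as a monoid. It is `⊤` if no finite set of idempotents generates `M`. -/
noncomputable def monoidIdRank (M : Type*) [Monoid M] : ℕ∞ :=
  ⨅ U ∈ {U : Set M | U ⊆ {e | IsIdempotentElem e} ∧ Submonoid.closure U = ⊤}, U.encard

namespace Finpartition

variable {X : Type*} [Fintype X] [DecidableEq X]

/-- The monoid `T(X, P)` of all maps `f : X → X` that send every block of `P` into a block of `P`.
The multiplication of `Function.End X` is `(f * g) x = f (g x)`; composing in the other order gives
the opposite monoid, which has the same generating sets and the same idempotents. -/
def transformations (P : Finpartition (Finset.univ : Finset X)) : Submonoid (Function.End X) where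
  carrier := {f | ∀ C ∈ P.parts, ∃ D ∈ P.parts, ∀ x ∈ C, f x ∈ D}
  one_mem' := fun C hC => ⟨C, hC, fun _ hx => hx⟩
  mul_mem' := by
    intro f g hf hg C hC
    obtain ⟨D, hD, h1⟩ := hg C hC
    obtain ⟨E, hE, h2⟩ := hf D hD
    exact ⟨E, hE, fun x hx => h2 _ (h1 x hx)⟩

/-- The monoid `E(X, P)` generated by the idempotents of `T(X, P)`. -/
def idempotentGenerated (P : Finpartition (Finset.univ : Finset X)) :
    Submonoid P.transformations :=
  Submonoid.closure {f | IsIdempotentElem f}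

/-- All blocks of `P` have the same size. -/
def BlocksEqualSize (P : Finpartition (Finset.univ : Finset X)) : Prop :=
  ∀ C ∈ P.parts, ∀ D ∈ P.parts, C.card = D.card

/-- `μ_i`: the number of blocks of size `i`. -/
def blockCount (P : Finpartition (Finset.univ : Finset X)) (i : ℕ) : ℕ :=
  {C ∈ P.parts | C.card = i}.card

/-- `ν_i`: the number of `j` with `1 ≤ j < i` such that some block has size `j`. -/
def smallerSizeCount (P : Finpartition (Finset.univ : Finset X)) (i : ℕ) : ℕ :=
  {j ∈ Finset.Ico 1 i | ∃ C ∈ P.parts, C.card = j}.card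

end Finpartition

/-- Howie's numbers `ρ_k`. -/
def howieNumber (k : ℕ) : ℕ := if k = 2 then 2 else k.choose 2

/-- The number `ρ` attached to the partition `P` of `X`, with `n = |X|`. The division in the last
sum is exact. -/
def Finpartition.rho {X : Type*} [Fintype X] [DecidableEq X]
    (P : Finpartition (Finset.univ : Finset X)) : ℕ :=
  (∑ i ∈ Finset.Icc 1 (Fintype.card X),
    (P.blockCount i * howieNumber i + i ! * (P.blockCount i).choose 2
      + P.blockCount i * P.smallerSizeCount i))
  + ∑ i ∈ Finset.Icc 1 (Fintype.card X), ∑ j ∈ Finset.Ioc i (Fintype.card X),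
      P.blockCount i * P.blockCount j * (j ! / (j - i)!)

set_option linter.unusedSectionVars false
/-! ### Counting -/

namespace PartitionRank

open Finset

/-! Fix an order `κ` on points and an order `r` on blocks that refines size. The terms of ρ count an
explicit type `GenIndex` with three kinds of index: pairs of points in one block, embeddings of a
block into a later block, and pairs of a block and a smaller block size.

Lower bound: every generating set contains, for each index, a generator realizing it
(`exists_realizes`), and a map realizes at most one index (`Realizes.unique`). For the first two
kinds, take the idempotent that collapses the pair, or moves the block along the embedding. Its
kernel is minimal among kernels of nontrivial idempotents, so in any factorization the first
nontrivial factor applied already has that kernel. In a two-point block both collapses have the same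
kernel, but looking at the last factor applied shows that both are generators. For the third kind,
follow a product that maps C onto a smaller block D: the generator that first moves a block larger
than D must shrink C to exactly |D| points (`exists_generator_shrinks`).

Upper bound: all idempotents are obtained from collapses inside blocks, injective moves of one
block, and one onto move per block and smaller size (`idempotentSubmonoid_le_of_forall`). Opposite
moves with the same kernel need not all be supplied. On at least three points of a block, or three
singleton blocks, a tournament with one reversed arc is enough (`collapse_mem_of_tournament`).
Between two blocks of equal size at least two, one bijection used backwards and the others forwards
are enough (`moveBlock_mem_of_reference`).

Exactly two singleton blocks {c}, {d} are the exception. Idempotent generating sets must contain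
both c ↦ d and d ↦ c, which share one index (`collapse_mem_of_two_singletons`), so one extra
generator is needed. Without idempotency it is saved: as block sizes differ there is a larger block,
and one non-idempotent map can do the work of both d ↦ c and a move of c into that block
(`closure_range_of_two_singletons`). -/

lemma card_offDiag_filter_lt {α : Type*} [DecidableEq α] (s : Finset α) (κ : α → ℕ)
    (hκ : Function.Injective κ) :
    (s.offDiag.filter fun p => κ p.1 < κ p.2).card = s.card.choose 2 := by
  have hsw : (s.offDiag.filter fun p => κ p.2 < κ p.1).card
      = (s.offDiag.filter fun p => κ p.1 < κ p.2).card := by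
    refine Finset.card_bij (fun p _ => (p.2, p.1)) ?_ ?_ ?_
    · rintro ⟨a, b⟩ h
      simp only [mem_filter, mem_offDiag] at h ⊢
      exact ⟨⟨h.1.2.1, h.1.1, h.1.2.2.symm⟩, h.2⟩
    · rintro ⟨a, b⟩ _ ⟨c, d⟩ _ h
      simp only [Prod.mk.injEq] at h ⊢
      exact ⟨h.2, h.1⟩
    · rintro ⟨a, b⟩ h
      simp only [mem_filter, mem_offDiag] at h
      refine ⟨(b, a), ?_, rfl⟩
      simp only [mem_filter, mem_offDiag]
      exact ⟨⟨h.1.2.1, h.1.1, h.1.2.2.symm⟩, h.2⟩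
  have hadd := Finset.card_filter_add_card_filter_not (s := s.offDiag) (fun p => κ p.1 < κ p.2)
  have hnot : (s.offDiag.filter fun p => ¬ κ p.1 < κ p.2)
      = s.offDiag.filter fun p => κ p.2 < κ p.1 := by
    apply Finset.filter_congr
    rintro ⟨a, b⟩ h
    simp only [mem_offDiag] at h
    have : κ a ≠ κ b := fun e => h.2.2 (hκ e)
    simp only
    omega
  rw [hnot, hsw, offDiag_card] at hadd
  rw [Nat.choose_two_right, Nat.mul_sub, mul_one]
  omega

/-- Lexicographic order: size first, then an arbitrary enumeration as tie-break. It selects one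
direction for each pair of blocks, and always the smaller-to-larger one when sizes differ. -/
lemma exists_rank_function (X : Type*) [Fintype X] [DecidableEq X] :
    ∃ r : Finset X → ℕ, Function.Injective r ∧ ∀ C D : Finset X, C.card < D.card → r C < r D := by
  classical
  let N := Fintype.card (Finset X)
  let e := Fintype.equivFin (Finset X)
  refine ⟨fun C => C.card * N + e C, ?_, ?_⟩
  · intro C D h
    have h1 : (e C : ℕ) < N := (e C).2
    have h2 : (e D : ℕ) < N := (e D).2
    simp only at h
    rcases lt_trichotomy C.card D.card with hl | hl | hl
    · have := Nat.mul_le_mul_right N (Nat.succ_le_of_lt hl)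
      rw [Nat.succ_mul] at this; omega
    · rw [hl] at h
      exact e.injective (Fin.ext (by omega))
    · have := Nat.mul_le_mul_right N (Nat.succ_le_of_lt hl)
      rw [Nat.succ_mul] at this; omega
  · intro C D hl
    have h1 : (e C : ℕ) < N := (e C).2
    have := Nat.mul_le_mul_right N (Nat.succ_le_of_lt hl)
    rw [Nat.succ_mul] at this
    simp only; omega

variable {X : Type*} [Fintype X] [DecidableEq X] (P : Finpartition (Finset.univ : Finset X))

/-- Ordered pairs of points of one block, one for each unordered pair unless the block has two
elements. -/
abbrev PairIndex (κ : X → ℕ) : Type _ :=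
  Σ C : {C // C ∈ P.parts},
    {p : X × X // p ∈ C.1.offDiag.filter fun p => C.1.card = 2 ∨ κ p.1 < κ p.2}

/-- Embeddings of a block into another block that comes later in the order given by `r`. -/
abbrev EmbIndex (r : Finset X → ℕ) : Type _ :=
  Σ C : {C // C ∈ P.parts}, Σ D : {D // D ∈ P.parts.filter fun D => r C.1 < r D}, (C.1 ↪ D.1)

/-- A block together with a smaller block size. -/
abbrev SizeIndex : Type _ :=
  Σ C : {C // C ∈ P.parts},
    {j // j ∈ (Finset.Ico 1 C.1.card).filter fun j => ∃ D ∈ P.parts, D.card = j}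

/-- The index type of a smallest generating set. -/
abbrev GenIndex (κ : X → ℕ) (r : Finset X → ℕ) : Type _ :=
  PairIndex P κ ⊕ (EmbIndex P r ⊕ SizeIndex P)

lemma card_mem_Icc {C : Finset X} (hC : C ∈ P.parts) : C.card ∈ Icc 1 (Fintype.card X) :=
  mem_Icc.2 ⟨(P.nonempty_of_mem_parts hC).card_pos, card_le_univ C⟩

lemma sum_parts_eq (f : ℕ → ℕ) :
    ∑ C ∈ P.parts, f C.card = ∑ i ∈ Icc 1 (Fintype.card X), P.blockCount i * f i := by
  rw [← Finset.sum_fiberwise_of_maps_to (g := Finset.card) fun C hC => card_mem_Icc P hC]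
  refine sum_congr rfl fun i _ => ?_
  rw [Finset.sum_congr rfl (g := fun _ => f i) fun C hC => by rw [(mem_filter.1 hC).2]]
  simp [Finpartition.blockCount]

/-- A two-point block keeps both ordered pairs, which is the exceptional value 2 of Howie's number;
any other block keeps one order per pair. -/
lemma card_pairIndex (κ : X → ℕ) (hκ : Function.Injective κ) :
    Fintype.card (PairIndex P κ)
      = ∑ i ∈ Icc 1 (Fintype.card X), P.blockCount i * howieNumber i := by
  rw [Fintype.card_sigma, ← sum_parts_eq, ← Finset.sum_coe_sort P.parts]
  refine Finset.sum_congr rfl fun C _ => ?_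
  rw [Fintype.card_coe]
  by_cases h : C.1.card = 2
  · simp [h, howieNumber, offDiag_card]
  · simp only [h, false_or, howieNumber, if_false]
    exact card_offDiag_filter_lt _ κ hκ

lemma card_sizeIndex :
    Fintype.card (SizeIndex P)
      = ∑ i ∈ Icc 1 (Fintype.card X), P.blockCount i * P.smallerSizeCount i := by
  rw [Fintype.card_sigma, ← sum_parts_eq, ← Finset.sum_coe_sort P.parts]
  refine Finset.sum_congr rfl fun C _ => ?_
  rw [Fintype.card_coe]; rfl

lemma sum_equal_size (r : Finset X → ℕ) (hr : Function.Injective r) :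
    ∑ C ∈ P.parts, ∑ D ∈ P.parts with D.card = C.card ∧ r C < r D, D.card.descFactorial C.card
      = ∑ i ∈ Icc 1 (Fintype.card X), i ! * (P.blockCount i).choose 2 := by
  rw [← Finset.sum_fiberwise_of_maps_to (g := Finset.card) fun C hC => card_mem_Icc P hC]
  refine sum_congr rfl fun i _ => ?_
  have h : ∀ C ∈ P.parts.filter (fun C => C.card = i),
      ∑ D ∈ P.parts with D.card = C.card ∧ r C < r D, D.card.descFactorial C.card
      = i ! * ((P.parts.filter (fun C => C.card = i)).filter (fun D => r C < r D)).card := by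
    intro C hC
    have hC := (mem_filter.1 hC).2
    rw [Finset.sum_congr rfl (g := fun _ => i !), sum_const, smul_eq_mul, mul_comm, filter_filter]
    · simp only [hC]
    · intro D hD
      rw [(mem_filter.1 hD).2.1, hC, Nat.descFactorial_self]
  rw [sum_congr rfl h, ← mul_sum, Finpartition.blockCount, ← card_offDiag_filter_lt _ r hr]
  congr 1
  rw [← Finset.card_sigma]
  refine Finset.card_bij (fun p _ => (p.1, p.2)) ?_ ?_ ?_
  · rintro ⟨a, b⟩ h
    simp only [mem_sigma, mem_filter, mem_offDiag] at h ⊢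
    exact ⟨⟨h.1, h.2.1, fun e => by have := h.2.2; rw [e] at this; omega⟩, h.2.2⟩
  · rintro ⟨a, b⟩ _ ⟨c, d⟩ _ h
    simp only [Prod.mk.injEq] at h
    rw [h.1, h.2]
  · rintro ⟨a, b⟩ h
    simp only [mem_filter, mem_offDiag] at h
    refine ⟨⟨a, b⟩, ?_, rfl⟩
    simp only [mem_sigma, mem_filter]
    exact ⟨h.1.1, h.1.2.1, h.2⟩

lemma sum_less_size :
    ∑ C ∈ P.parts, ∑ D ∈ P.parts with C.card < D.card, D.card.descFactorial C.card
      = ∑ i ∈ Icc 1 (Fintype.card X), ∑ j ∈ Ioc i (Fintype.card X),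
          P.blockCount i * P.blockCount j * (j ! / (j - i)!) := by
  rw [sum_parts_eq P fun i => ∑ D ∈ P.parts with i < D.card, D.card.descFactorial i]
  refine sum_congr rfl fun i _ => ?_
  rw [← Finset.sum_fiberwise_of_maps_to (g := Finset.card) (t := Ioc i (Fintype.card X)), mul_sum]
  · refine sum_congr rfl fun j hj => ?_
    have hij := (mem_Ioc.1 hj).1
    rw [mul_assoc, ← Nat.descFactorial_eq_div hij.le,
      Finset.sum_congr rfl (g := fun _ => j.descFactorial i) fun C hC => by
        rw [(mem_filter.1 hC).2], sum_const, smul_eq_mul, filter_filter]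
    congr 3
    apply filter_congr
    intro D _
    constructor
    · exact fun h => h.2
    · exact fun h => ⟨h ▸ hij, h⟩
  · intro D hD
    exact mem_Ioc.2 ⟨(mem_filter.1 hD).2, card_le_univ D⟩

/-- A later block is either of equal size, contributing i! bijections once per unordered pair, or
strictly larger, contributing the falling factorial j!/(j-i)!. -/
lemma card_embIndex (r : Finset X → ℕ) (hr : Function.Injective r)
    (hlt : ∀ C D : Finset X, C.card < D.card → r C < r D) :
    Fintype.card (EmbIndex P r)
      = ∑ i ∈ Icc 1 (Fintype.card X), i ! * (P.blockCount i).choose 2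
        + ∑ i ∈ Icc 1 (Fintype.card X), ∑ j ∈ Ioc i (Fintype.card X),
          P.blockCount i * P.blockCount j * (j ! / (j - i)!) := by
  rw [← sum_equal_size P r hr, ← sum_less_size P, ← sum_add_distrib, Fintype.card_sigma,
    ← Finset.sum_coe_sort P.parts]
  refine Finset.sum_congr rfl fun C _ => ?_
  rw [Fintype.card_sigma, ← Finset.sum_union]
  · have hset : (P.parts.filter fun D => r C.1 < r D)
        = (P.parts.filter fun D => D.card = C.1.card ∧ r C.1 < r D)
          ∪ P.parts.filter fun D => C.1.card < D.card := by
      ext D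
      simp only [mem_union, mem_filter]
      have := hlt C D
      have := hlt D C
      constructor
      · rintro ⟨h1, h2⟩
        rcases lt_trichotomy C.1.card D.card with h | h | h
        · exact Or.inr ⟨h1, h⟩
        · exact Or.inl ⟨h1, h.symm, h2⟩
        · have := hlt D C h; omega
      · rintro (h | h)
        · exact ⟨h.1, h.2.2⟩
        · exact ⟨h.1, hlt _ _ h.2⟩
    rw [← hset, ← Finset.sum_coe_sort (P.parts.filter fun D => r C.1 < r D)]
    refine Finset.sum_congr rfl fun D _ => ?_
    rw [Fintype.card_embedding_eq, Fintype.card_coe, Fintype.card_coe]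
  · rw [Finset.disjoint_left]
    intro D h1 h2
    have := (mem_filter.1 h1).2.1
    have := (mem_filter.1 h2).2
    omega

lemma card_genIndex (κ : X → ℕ) (hκ : Function.Injective κ) (r : Finset X → ℕ)
    (hr : Function.Injective r) (hlt : ∀ C D : Finset X, C.card < D.card → r C < r D) :
    Fintype.card (GenIndex P κ r) = P.rho := by
  rw [Fintype.card_sum, Fintype.card_sum, card_pairIndex P κ hκ, card_embIndex P r hr hlt,
    card_sizeIndex, Finpartition.rho, sum_add_distrib, sum_add_distrib]
  ring

end PartitionRank

/-! ### Products of generators -/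

namespace PartitionRank

open Finset

/-! ### Factorizations into generators -/

section Monoid

variable {M : Type*} [Monoid M]

lemma exists_eq_mul_of_mem_closure {U : Set M} {f : M} (hf : f ∈ Submonoid.closure U)
    (h1 : f ≠ 1) : ∃ u ∈ U, u ≠ 1 ∧ ∃ g ∈ Submonoid.closure U, f = g * u := by
  induction hf using Submonoid.closure_induction_right with
  | one => exact absurd rfl h1
  | mul_right x hx y hy ih =>
    by_cases hy1 : y = 1
    · subst hy1
      rw [mul_one] at h1 ⊢
      exact ih h1
    · exact ⟨y, hy, hy1, x, hx, rfl⟩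

lemma exists_eq_mul_of_mem_closure' {U : Set M} {f : M} (hf : f ∈ Submonoid.closure U)
    (h1 : f ≠ 1) : ∃ u ∈ U, u ≠ 1 ∧ ∃ g ∈ Submonoid.closure U, f = u * g := by
  induction hf using Submonoid.closure_induction_left with
  | one => exact absurd rfl h1
  | mul_left y hy x hx ih =>
    by_cases hy1 : y = 1
    · subst hy1
      rw [one_mul] at h1 ⊢
      exact ih h1
    · exact ⟨y, hy, hy1, x, hx, rfl⟩

/-- In a product of generators that leads out of `p`, some generator is the first to do so. -/
lemma exists_first_exit {V : Set M} (p : M → Prop) {h u : M} (hp : p h)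
    (hu : u ∈ Submonoid.closure V) (hn : ¬ p (u * h)) :
    ∃ g ∈ Submonoid.closure V, ∃ v ∈ V, ∃ h' ∈ Submonoid.closure V,
      u = g * (v * h') ∧ p (h' * h) ∧ ¬ p (v * h' * h) := by
  induction hu using Submonoid.closure_induction_left with
  | one => rw [one_mul] at hn; exact absurd hp hn
  | mul_left y hy x hx ih =>
    by_cases hxp : p (x * h)
    · exact ⟨1, one_mem _, y, hy, x, hx, by rw [one_mul], hxp, hn⟩
    · obtain ⟨g, hg, v, hv, h', hh', rfl, h1, h2⟩ := ih hxp
      exact ⟨y * g, mul_mem (Submonoid.subset_closure hy) hg, v, hv, h', hh',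
        (mul_assoc _ _ _).symm, h1, h2⟩

end Monoid

/-! ### Elementary idempotents, block-injective maps and minimal kernels -/

variable {X : Type*} [Fintype X] [DecidableEq X] (P : Finpartition (Finset.univ : Finset X))

/-- The set of idempotents of `T(X, P)`, as maps. -/
def idempotentSet : Set (Function.End X) := {f | f ∈ P.transformations ∧ f * f = f}

/-- The monoid `E(X, P)` as a submonoid of all maps. -/
def idempotentSubmonoid : Submonoid (Function.End X) := Submonoid.closure (idempotentSet P)

/-- The map sending `x` to `y` and fixing all other points. -/
def collapse (x y : X) : Function.End X := fun a => if a = x then y else a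

/-- The map equal to `η` on `C` and fixing all points outside `C`. -/
def moveBlock (C : Finset X) (η : X → X) : Function.End X := fun a => if a ∈ C then η a else a

lemma collapse_apply (x y a : X) : collapse x y a = if a = x then y else a := rfl

lemma moveBlock_apply (C : Finset X) (η : X → X) (a : X) :
    moveBlock C η a = if a ∈ C then η a else a := rfl

lemma moveBlock_of_mem {C : Finset X} (η : X → X) {a : X} (h : a ∈ C) :
    moveBlock C η a = η a := if_pos h

lemma moveBlock_of_notMem {C : Finset X} (η : X → X) {a : X} (h : a ∉ C) :
    moveBlock C η a = a := if_neg h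

lemma end_mul_apply (f g : Function.End X) (a : X) : (f * g) a = f (g a) := rfl

lemma end_one_apply (a : X) : (1 : Function.End X) a = a := rfl

variable {P}

lemma mem_block {C : Finset X} (hC : C ∈ P.parts) {x : X} : x ∈ C ↔ P.part x = C :=
  (P.part_eq_iff_mem hC).symm

lemma mem_part_univ (x : X) : x ∈ P.part x := P.mem_part (mem_univ x)

lemma part_mem_parts (x : X) : P.part x ∈ P.parts := P.part_mem.2 (mem_univ x)

lemma mem_transformations {f : Function.End X} :
    f ∈ P.transformations ↔ ∀ x y, P.part x = P.part y → P.part (f x) = P.part (f y) := by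
  constructor
  · intro h x y hxy
    obtain ⟨D, hD, hf⟩ := h _ (part_mem_parts x)
    rw [P.part_eq_of_mem hD (hf x (mem_part_univ x)),
      P.part_eq_of_mem hD (hf y (hxy ▸ mem_part_univ y))]
  · intro h C hC
    obtain ⟨x, hx⟩ := P.nonempty_of_mem_parts hC
    refine ⟨P.part (f x), part_mem_parts _, fun y hy => ?_⟩
    rw [h x y (by rw [(mem_block hC).1 hx, (mem_block hC).1 hy])]
    exact mem_part_univ _

lemma idempotentSubmonoid_le : idempotentSubmonoid P ≤ P.transformations :=
  Submonoid.closure_le.2 fun _ h => h.1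

lemma collapse_mem {x y : X} (h : P.part x = P.part y) : collapse x y ∈ idempotentSet P := by
  refine ⟨mem_transformations.2 fun a b hab => ?_, ?_⟩
  · have : ∀ c, P.part (collapse x y c) = P.part c := by
      intro c
      rw [collapse_apply]
      split_ifs with hc
      · rw [hc, h]
      · rfl
    rw [this, this, hab]
  · funext a
    simp only [end_mul_apply, collapse_apply]
    grind

lemma moveBlock_mem {C D : Finset X} (hC : C ∈ P.parts) (hD : D ∈ P.parts) (hCD : C ≠ D)
    {η : X → X} (hη : ∀ c ∈ C, η c ∈ D) : moveBlock C η ∈ idempotentSet P := by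
  refine ⟨mem_transformations.2 fun a b hab => ?_, ?_⟩
  · by_cases ha : a ∈ C
    · have hb : b ∈ C := (mem_block hC).2 (hab ▸ (mem_block hC).1 ha)
      rw [moveBlock_of_mem _ ha, moveBlock_of_mem _ hb, (mem_block hD).1 (hη a ha),
        (mem_block hD).1 (hη b hb)]
    · have hb : b ∉ C := fun hb => ha ((mem_block hC).2 (hab ▸ (mem_block hC).1 hb))
      rw [moveBlock_of_notMem _ ha, moveBlock_of_notMem _ hb, hab]
  · funext a
    by_cases ha : a ∈ C
    · have : η a ∉ C := fun h => hCD
        (((mem_block hC).1 h).symm.trans ((mem_block hD).1 (hη a ha)))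
      rw [end_mul_apply, moveBlock_of_mem _ ha, moveBlock_of_notMem _ this]
    · rw [end_mul_apply, moveBlock_of_notMem _ ha, moveBlock_of_notMem _ ha]

lemma moveBlock_part {C D : Finset X} (hD : D ∈ P.parts)
    {η : X → X} (hη : ∀ c ∈ C, η c ∈ D) (a : X) :
    P.part (moveBlock C η a) = if a ∈ C then D else P.part a := by
  split_ifs with ha
  · rw [moveBlock_of_mem _ ha, (mem_block hD).1 (hη a ha)]
  · rw [moveBlock_of_notMem _ ha]

/-- The map on blocks induced by `f` is injective. -/
def BlockInjective (P : Finpartition (Finset.univ : Finset X)) (f : Function.End X) : Prop :=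
  ∀ a b, P.part (f a) = P.part (f b) → P.part a = P.part b

lemma BlockInjective.of_mul {f g : Function.End X} (hg : g ∈ P.transformations)
    (h : BlockInjective P (g * f)) : BlockInjective P f :=
  fun a b hab => h a b (mem_transformations.1 hg _ _ hab)

lemma idempotent_apply {e : Function.End X} (he : e ∈ idempotentSet P) (a : X) :
    e (e a) = e a := congrFun he.2 a

/-- The first factor e of a block-injective product is block-injective, and `e (e a) = e a` then
forces e to preserve every block. So does the rest of the product, by induction. -/
lemma BlockInjective.part_apply {f : Function.End X} (hf : f ∈ idempotentSubmonoid P)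
    (h : BlockInjective P f) (a : X) : P.part (f a) = P.part a := by
  unfold idempotentSubmonoid at hf
  revert a
  induction hf using Submonoid.closure_induction_right with
  | one => exact fun _ => rfl
  | mul_right g hg e he ih =>
    have hgT := mem_transformations.1 (idempotentSubmonoid_le hg)
    have he' : ∀ a, P.part (e a) = P.part a := fun a =>
      h.of_mul (idempotentSubmonoid_le hg) _ _ (by rw [idempotent_apply he])
    have hg' : BlockInjective P g := by
      intro a b hab
      apply h
      rw [end_mul_apply, end_mul_apply, hgT _ _ (he' a), hgT _ _ (he' b), hab]
    intro a
    rw [end_mul_apply, ih hg', he']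

/-- The same argument on points: an idempotent factor that preserves C and is injective on it fixes
C pointwise. -/
lemma BlockInjective.eq_of_injOn {f : Function.End X} (hf : f ∈ idempotentSubmonoid P)
    (h : BlockInjective P f) {C : Finset X} (hC : C ∈ P.parts) (hi : Set.InjOn f C) :
    ∀ a ∈ C, f a = a := by
  unfold idempotentSubmonoid at hf
  induction hf using Submonoid.closure_induction_right with
  | one => exact fun _ _ => rfl
  | mul_right g hg e he ih =>
    have hgT := mem_transformations.1 (idempotentSubmonoid_le hg)
    have he0 := h.of_mul (idempotentSubmonoid_le hg)
    have he' : ∀ a, P.part (e a) = P.part a :=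
      he0.part_apply (Submonoid.subset_closure he)
    have hg' : BlockInjective P g := by
      intro a b hab
      apply h
      rw [end_mul_apply, end_mul_apply, hgT _ _ (he' a), hgT _ _ (he' b), hab]
    have heC : ∀ a ∈ C, e a = a := by
      intro a ha
      apply hi _ ha
      · rw [end_mul_apply, end_mul_apply, idempotent_apply he]
      · exact (mem_block hC).2 ((he' a).trans ((mem_block hC).1 ha))
    intro a ha
    rw [end_mul_apply, heC a ha]
    apply ih hg' _ a ha
    intro x hx y hy hxy
    apply hi hx hy
    rw [end_mul_apply, end_mul_apply, heC x hx, heC y hy, hxy]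

/-- `u` and `m` have the same kernel. -/
def SameKernel (u m : Function.End X) : Prop := ∀ a b, u a = u b ↔ m a = m b

/-- `m` has a kernel that is minimal among the kernels of idempotents, in the form used for
products. -/
lemma sameKernel_of_minimal {m : Function.End X}
    (hmin : ∀ e ∈ idempotentSet P, e ≠ 1 → (∀ a b, e a = e b → m a = m b) →
      ∀ a b, m a = m b → e a = e b)
    {u : Function.End X} (hu : u ∈ idempotentSubmonoid P) (hu1 : u ≠ 1)
    (hle : ∀ a b, u a = u b → m a = m b) : SameKernel u m := by
  -- The kernel of the factor applied first lies inside the kernel of the product, so minimality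
  -- squeezes both between the same bounds.
  obtain ⟨e, he, he1, g, -, rfl⟩ := exists_eq_mul_of_mem_closure hu hu1
  intro a b
  refine ⟨hle a b, fun h => ?_⟩
  have hle' : ∀ a b, e a = e b → m a = m b := fun a b h => hle a b (congrArg g h)
  exact congrArg g (hmin e he he1 hle' a b h)

lemma end_ne_one {e : Function.End X} (he : e ≠ 1) : ∃ z, e z ≠ z := by
  by_contra! h
  exact he (funext h)

lemma collapse_eq_iff {x y : X} (hxy : x ≠ y) (a b : X) :
    collapse x y a = collapse x y b ↔ a = b ∨ (a = x ∧ b = y) ∨ (a = y ∧ b = x) := by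
  simp only [collapse_apply]
  grind

lemma collapse_minimal {x y : X} (hxy : x ≠ y) : ∀ e ∈ idempotentSet P, e ≠ 1 →
    (∀ a b, e a = e b → collapse x y a = collapse x y b) →
      ∀ a b, collapse x y a = collapse x y b → e a = e b := by
  intro e he he1 hle a b hab
  obtain ⟨z, hz⟩ := end_ne_one he1
  have hz1 := idempotent_apply he z
  have hz2 := (collapse_eq_iff hxy _ _).1 (hle _ _ hz1)
  rw [collapse_eq_iff hxy] at hab
  grind

lemma moveBlock_eq_iff {C : Finset X} {η : X → X} (hη : Set.InjOn η C) (hd : ∀ c ∈ C, η c ∉ C)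
    (a b : X) : moveBlock C η a = moveBlock C η b ↔
      a = b ∨ (a ∈ C ∧ b = η a) ∨ (b ∈ C ∧ a = η b) := by
  simp only [moveBlock_apply]
  constructor
  · intro h
    by_cases ha : a ∈ C <;> by_cases hb : b ∈ C <;> simp only [ha, hb, if_true, if_false] at h
    · exact Or.inl (hη ha hb h)
    · exact Or.inr (Or.inl ⟨ha, h.symm⟩)
    · exact Or.inr (Or.inr ⟨hb, h⟩)
    · exact Or.inl h
  · rintro (rfl | ⟨h, rfl⟩ | ⟨h, rfl⟩)
    · rfl
    · rw [if_pos h, if_neg (hd _ h)]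
    · rw [if_pos h, if_neg (hd _ h)]

/-- A nontrivial idempotent with a smaller kernel sends some a ∈ C to `η a`, or `η a` to a. Since it
respects blocks, it then sends all of C into D or all of D into C, and its kernel must identify
every c with `η c`. -/
lemma moveBlock_minimal {C D : Finset X} (hC : C ∈ P.parts) (hD : D ∈ P.parts) (hCD : C ≠ D)
    {η : X → X} (hη : ∀ c ∈ C, η c ∈ D) (hi : Set.InjOn η C) : ∀ e ∈ idempotentSet P, e ≠ 1 →
    (∀ a b, e a = e b → moveBlock C η a = moveBlock C η b) →
      ∀ a b, moveBlock C η a = moveBlock C η b → e a = e b := by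
  intro e he he1 hle
  have hdis : ∀ c ∈ D, c ∉ C := fun c h1 h2 =>
    hCD (((mem_block hC).1 h2).symm.trans ((mem_block hD).1 h1))
  have hd : ∀ c ∈ C, η c ∉ C := fun c hc => hdis _ (hη c hc)
  have heT := mem_transformations.1 he.1
  obtain ⟨z, hz⟩ := end_ne_one he1
  have hz1 := idempotent_apply he z
  have key : ∀ c ∈ C, e c = e (η c) := by
    have hcase : ∃ a ∈ C, e a = η a ∨ e (η a) = a := by
      rcases (moveBlock_eq_iff hi hd _ _).1 (hle _ _ hz1) with h | ⟨h1, h2⟩ | ⟨h1, h2⟩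
      · exact absurd h hz
      · exact ⟨e z, h1, Or.inr (by rw [← h2])⟩
      · exact ⟨z, h1, Or.inl h2⟩
    obtain ⟨a, ha, h | h⟩ := hcase
    · intro c hc
      have hec : e c ∈ D := by
        rw [mem_block hD, heT c a (by rw [(mem_block hC).1 hc, (mem_block hC).1 ha]), h,
          ← mem_block hD]
        exact hη a ha
      have := hle _ _ (idempotent_apply he c)
      rw [moveBlock_of_mem _ hc, moveBlock_of_notMem _ (hdis _ hec)] at this
      rw [← this, idempotent_apply he]
    · intro c hc
      have hec : e (η c) ∈ C := by
        rw [mem_block hC, heT (η c) (η a)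
          (by rw [(mem_block hD).1 (hη c hc), (mem_block hD).1 (hη a ha)]), h, ← mem_block hC]
        exact ha
      have := hle _ _ (idempotent_apply he (η c))
      rw [moveBlock_of_mem _ hec, moveBlock_of_notMem _ (hd c hc)] at this
      have := hi hec hc this
      rw [← idempotent_apply he (η c), this]
  intro a b hab
  rcases (moveBlock_eq_iff hi hd _ _).1 hab with rfl | ⟨h, rfl⟩ | ⟨h, rfl⟩
  · rfl
  · exact key a h
  · exact (key b h).symm

/-! ### Generators forced in every generating set -/

section Generators

variable {U : Set (Function.End X)}

lemma exists_generator_sameKernel (hU : Submonoid.closure U = idempotentSubmonoid P)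
    {m : Function.End X} (hm : m ∈ idempotentSet P) (hm1 : m ≠ 1)
    (hmin : ∀ e ∈ idempotentSet P, e ≠ 1 → (∀ a b, e a = e b → m a = m b) →
      ∀ a b, m a = m b → e a = e b) :
    ∃ u ∈ U, SameKernel u m ∧ (BlockInjective P m → BlockInjective P u) := by
  have hmU : m ∈ Submonoid.closure U := hU ▸ Submonoid.subset_closure hm
  obtain ⟨u, hu, hu1, g, hg, hgu⟩ := exists_eq_mul_of_mem_closure hmU hm1
  refine ⟨u, hu, sameKernel_of_minimal hmin (hU ▸ Submonoid.subset_closure hu) hu1 ?_, ?_⟩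
  · intro a b h
    rw [hgu]
    exact congrArg g h
  · intro h
    rw [hgu] at h
    exact h.of_mul (idempotentSubmonoid_le (hU ▸ hg))

lemma collapse_ne_one {x y : X} (hxy : x ≠ y) : collapse x y ≠ 1 := by
  intro h
  have := congrFun h x
  rw [collapse_apply, if_pos rfl, end_one_apply] at this
  exact hxy this.symm

lemma collapse_blockInjective {x y : X} (h : P.part x = P.part y) :
    BlockInjective P (collapse x y) := by
  have : ∀ c, P.part (collapse x y c) = P.part c := by
    intro c
    rw [collapse_apply]
    split_ifs with hc
    · rw [hc, h]
    · rfl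
  intro a b hab
  rwa [this, this] at hab

/-- The kernel cannot tell the two collapses of {x, y} apart, but the last factor applied can. That
factor u preserves blocks and is the identity off {x, y}. Being nontrivial it is constant on {x, y},
and the value must be y. -/
lemma collapse_mem_of_card_eq_two (hU : Submonoid.closure U = idempotentSubmonoid P)
    {x y : X} (hxy : x ≠ y) (h : P.part x = P.part y) (h2 : (P.part x).card = 2) :
    collapse x y ∈ U := by
  have hmU : collapse x y ∈ Submonoid.closure U :=
    hU ▸ Submonoid.subset_closure (collapse_mem h)
  obtain ⟨u, hu, hu1, g, hg, hgu⟩ := exists_eq_mul_of_mem_closure' hmU (collapse_ne_one hxy)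
  have huE : u ∈ idempotentSubmonoid P := hU ▸ Submonoid.subset_closure hu
  have hgE : g ∈ idempotentSubmonoid P := hU ▸ hg
  have huT := mem_transformations.1 (idempotentSubmonoid_le huE)
  have hb := collapse_blockInjective h
  have hgb : BlockInjective P g := by
    rw [hgu] at hb
    exact hb.of_mul (idempotentSubmonoid_le huE)
  have hgp := hgb.part_apply hgE
  have hub : BlockInjective P u := by
    intro a b hab
    apply hb
    rw [hgu, end_mul_apply, end_mul_apply, huT _ _ (hgp a), huT _ _ (hgp b), hab]
  have hblock : P.part x = {x, y} := by
    symm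
    apply Finset.eq_of_subset_of_card_le
    · intro z hz
      rw [mem_insert, mem_singleton] at hz
      rcases hz with rfl | rfl
      · exact mem_part_univ _
      · rw [h]; exact mem_part_univ _
    · rw [h2, card_pair hxy]
  have hoff : ∀ a, a ∉ P.part x → u a = a := by
    intro a ha
    have hne : ∀ c ∈ P.part a, c ≠ x := by
      rintro c hc rfl
      exact ha ((mem_block (part_mem_parts a)).1 hc ▸ mem_part_univ a)
    have hga : ∀ c ∈ P.part a, g c = c := by
      apply hgb.eq_of_injOn hgE (part_mem_parts a)
      intro c hc d hd hcd
      have : (u * g) c = (u * g) d := congrArg u hcd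
      rw [← hgu, collapse_apply, collapse_apply,
        if_neg (hne c hc), if_neg (hne d hd)] at this
      exact this
    have := congrFun hgu a
    rw [end_mul_apply, hga a (mem_part_univ a), collapse_apply,
      if_neg (hne a (mem_part_univ a))] at this
    exact this.symm
  have hninj : u x = u y := by
    by_contra hne
    have hinj : Set.InjOn u (P.part x) := by
      rw [hblock]
      intro a ha b hb hab
      simp only [coe_insert, coe_singleton, Set.mem_insert_iff, Set.mem_singleton_iff] at ha hb
      grind
    apply hu1
    funext a
    by_cases ha : a ∈ P.part x
    · exact hub.eq_of_injOn huE (part_mem_parts x) hinj a ha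
    · exact hoff a ha
  have hgx : g x ∈ ({x, y} : Finset X) := by
    rw [← hblock, ← hgp x]
    exact mem_part_univ _
  have hux : u x = y := by
    have := congrFun hgu x
    rw [end_mul_apply, collapse_apply, if_pos rfl] at this
    rw [mem_insert, mem_singleton] at hgx
    rcases hgx with hgx | hgx
    · rw [this, hgx]
    · rw [this, hgx, hninj]
  have : u = collapse x y := by
    funext a
    rw [collapse_apply]
    by_cases ha : a ∈ P.part x
    · rw [hblock, mem_insert, mem_singleton] at ha
      rcases ha with rfl | rfl
      · rw [if_pos rfl, hux]
      · rw [if_neg hxy.symm, ← hninj, hux]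
    · rw [hoff a ha, if_neg]
      rintro rfl
      exact ha (mem_part_univ _)
  exact this ▸ hu

/-- `u` shrinks the block `C` to `j` points, merges blocks, and is injective on every other block
with more than `j` points. -/
structure Shrinks (P : Finpartition (Finset.univ : Finset X)) (C : Finset X) (j : ℕ)
    (u : Function.End X) : Prop where
  lt : j < C.card
  card_image : (C.image u).card = j
  not_blockInjective : ¬ BlockInjective P u
  injOn : ∀ B ∈ P.parts, j < B.card → B ≠ C → Set.InjOn u B

lemma Shrinks.not_injOn {C : Finset X} {j : ℕ} {u : Function.End X} (h : Shrinks P C j u) :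
    ¬ Set.InjOn u C := fun hi => by
  have := h.card_image
  have h2 := h.lt
  rw [card_image_of_injOn hi] at this
  omega

/-- If the blocks differed, injectivity off the shrunk block would give |C| ≤ j' < |C'| ≤ j < |C|.
-/
lemma Shrinks.unique {C C' : Finset X} (hC : C ∈ P.parts) (hC' : C' ∈ P.parts) {j j' : ℕ}
    {u : Function.End X} (h : Shrinks P C j u) (h' : Shrinks P C' j' u) : C = C' ∧ j = j' := by
  have hCC : C = C' := by
    by_contra hne
    have h1 : ¬ j' < C.card := fun hl => h.not_injOn (h'.injOn C hC hl hne)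
    have h2 : ¬ j < C'.card := fun hl => h'.not_injOn (h.injOn C' hC' hl (Ne.symm hne))
    have := h.lt
    have := h'.lt
    omega
  subst hCC
  exact ⟨rfl, h.card_image.symm.trans h'.card_image⟩

lemma exists_generator_shrinks (hU : Submonoid.closure U = idempotentSubmonoid P)
    {C D : Finset X} (hC : C ∈ P.parts) (hD : D ∈ P.parts) (hlt : D.card < C.card)
    {σ : X → X} (hσ : C.image σ = D) : ∃ u ∈ U, Shrinks P C D.card u := by
  have hCD : C ≠ D := by rintro rfl; omega
  have hσD : ∀ c ∈ C, σ c ∈ D := fun c hc => hσ ▸ mem_image_of_mem σ hc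
  have hEU : moveBlock C σ ∈ Submonoid.closure U :=
    hU ▸ Submonoid.subset_closure (moveBlock_mem hC hD hCD hσD)
  have hpart := moveBlock_part (P := P) hD hσD
  have himg : (C.image (moveBlock C σ)) = D := by
    rw [← hσ]
    exact image_congr fun c hc => moveBlock_of_mem σ hc
  generalize hm : moveBlock C σ = m at hEU hpart himg
  have hmoff : ∀ a, a ∉ C → m a = a := fun a ha => by rw [← hm, moveBlock_of_notMem _ ha]
  -- The wanted u is the first generator that takes a block with more than |D| points out of its
  -- place.
  let p : Function.End X → Prop := fun f => ∀ x, D.card < (P.part x).card → P.part (f x) = P.part x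
  obtain ⟨c, hc⟩ := P.nonempty_of_mem_parts hC
  have hp1 : p 1 := fun _ _ => rfl
  have hpn : ¬ p (m * 1) := by
    intro h
    have := h c (by rwa [(mem_block hC).1 hc])
    rw [mul_one, hpart, if_pos hc, (mem_block hC).1 hc] at this
    exact hCD this.symm
  obtain ⟨g, hg, u, hu, h, hh, hmu, hph, hpu⟩ :=
    exists_first_exit p hp1 hEU hpn
  rw [mul_one] at hph hpu
  have huE : u ∈ idempotentSubmonoid P := hU ▸ Submonoid.subset_closure hu
  rw [hU] at hg hh
  have hgT := idempotentSubmonoid_le hg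
  -- The generator u need not be idempotent, so it is itself factored, and v is the idempotent
  -- factor that makes the exit.
  obtain ⟨g', hg', v, hv, h', hh', hu', hph', hpv⟩ := exists_first_exit p hph huE hpu
  have injOff : ∀ f f' : Function.End X, m = f' * f → ∀ B ∈ P.parts, B ≠ C → Set.InjOn f B := by
    rintro f f' hf B hB hBC a ha b hb hab
    have hn : ∀ a ∈ B, a ∉ C := fun a h1 h2 =>
      hBC (((mem_block hB).1 h1).symm.trans ((mem_block hC).1 h2))
    have : (f' * f) a = (f' * f) b := congrArg f' hab
    rwa [← hf, hmoff a (hn a ha), hmoff b (hn b hb)] at this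
  have hm1 : m = (g * u) * h := by rw [hmu, mul_assoc]
  have huT := idempotentSubmonoid_le huE
  refine ⟨u, hu, hlt, le_antisymm ?_ ?_, ?_, ?_⟩
  · obtain ⟨x, hx⟩ := not_forall.1 hpv
    obtain ⟨hxc, hx⟩ := Classical.not_imp.1 hx
    rw [mul_assoc, end_mul_apply] at hx
    set w := (h' * h) x with hw
    have hwx : P.part w = P.part x := hph' x hxc
    have hvw := idempotent_apply hv w
    have hvT := mem_transformations.1 hv.1
    have hm2 : m = (g * g') * (v * (h' * h)) := by
      rw [hmu, hu']; simp only [mul_assoc]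
    have hggT : g * g' ∈ P.transformations := mul_mem hgT (idempotentSubmonoid_le hg')
    -- Were the block of `v w` large, `h' * h` would preserve it and v would send it to itself. Then
    -- m would merge two distinct blocks larger than D, whereas it only merges C with D.
    have hsmall : (P.part (v w)).card ≤ D.card := by
      by_contra! hbig
      have h1 : P.part ((h' * h) (v w)) = P.part (v w) := hph' _ hbig
      have h2 : P.part (v ((h' * h) (v w))) = P.part (v w) := by
        rw [hvT _ _ h1, hvw]
      have h3 : P.part (m x) = P.part (m (v w)) := by
        rw [hm2]
        apply mem_transformations.1 hggT
        exact h2.symm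
      rw [hpart, hpart] at h3
      split_ifs at h3 with h4 h5 h5
      · exact hx (((mem_block hC).1 h5).trans ((mem_block hC).1 h4).symm)
      · rw [← h3] at hbig; omega
      · rw [h3] at hxc; omega
      · exact hx h3.symm
    have hmapsv : ∀ a, P.part a = P.part x → v a ∈ P.part (v w) := by
      intro a ha
      rw [mem_block (part_mem_parts _)]
      exact hvT _ _ (ha.trans hwx.symm)
    -- On any block other than C, m is injective, so the factor `v * (h' * h)` could not squeeze a
    -- large block into a small one.
    have hxC : P.part x = C := by
      by_contra hne
      have hi := injOff _ _ hm2 _ (part_mem_parts x) hne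
      have := card_le_card_of_injOn (s := P.part x) (t := P.part (v w)) _ (by
        intro a ha
        have ha' : P.part a = P.part x := (mem_block (part_mem_parts x)).1 ha
        apply hmapsv
        have := hph' a (by rwa [ha'])
        exact this.trans ha') hi
      omega
    have hh'C : ∀ a ∈ C, P.part (h' a) = P.part x := by
      intro a ha
      have h1 : P.part (h x) = P.part x := hph x hxc
      have h2 := mem_transformations.1 (idempotentSubmonoid_le hh') a (h x)
        (by rw [h1, hxC, (mem_block hC).1 ha])
      rw [h2]
      exact hwx
    refine le_trans ?_ hsmall
    have hsub : C.image u ⊆ (P.part (v w)).image g' := by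
      intro y hy
      obtain ⟨a, ha, rfl⟩ := mem_image.1 hy
      rw [hu']
      exact mem_image_of_mem g' (hmapsv _ (hh'C a ha))
    exact (card_le_card hsub).trans card_image_le
  · have hsub : D ⊆ (C.image u).image g := by
      rw [← himg]
      intro y hy
      obtain ⟨a, ha, rfl⟩ := mem_image.1 hy
      rw [hmu]
      refine mem_image_of_mem g (mem_image_of_mem u ?_)
      rw [mem_block hC, hph a (by rwa [(mem_block hC).1 ha]), (mem_block hC).1 ha]
    exact (card_le_card hsub).trans card_image_le
  · intro hb
    apply hpu
    intro x hx
    rw [end_mul_apply, hb.part_apply huE, hph x hx]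
  · intro B hB hBc hBC
    have hiu : Set.InjOn (u * h) B := injOff _ _ hmu B hB hBC
    have hih : Set.InjOn h B := injOff _ _ hm1 B hB hBC
    have hmaps : Set.MapsTo h B B := by
      intro a ha
      have ha' : P.part a = B := (mem_block hB).1 ha
      exact (mem_block hB).2 ((hph a (by rwa [ha'])).trans ha')
    have hsurj : Set.SurjOn h B B := Finset.surjOn_of_injOn_of_card_le h hmaps hih le_rfl
    intro a ha b hb hab
    obtain ⟨a', ha', rfl⟩ := hsurj ha
    obtain ⟨b', hb', rfl⟩ := hsurj hb
    rw [hiu ha' hb' hab]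

end Generators

end PartitionRank

/-! ### The lower bound -/

namespace PartitionRank

open Finset

variable {X : Type*} [Fintype X] [DecidableEq X] {P : Finpartition (Finset.univ : Finset X)}

/-- An embedding of finsets, extended by the identity. -/
def extendEmb {C D : Finset X} (η : C ↪ D) : X → X :=
  fun a => if h : a ∈ C then (η ⟨a, h⟩ : X) else a

lemma extendEmb_of_mem {C D : Finset X} (η : C ↪ D) {a : X} (h : a ∈ C) :
    extendEmb η a = η ⟨a, h⟩ := dif_pos h

lemma extendEmb_mem {C D : Finset X} (η : C ↪ D) {a : X} (h : a ∈ C) : extendEmb η a ∈ D := by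
  rw [extendEmb_of_mem η h]; exact (η ⟨a, h⟩).2

lemma extendEmb_injOn {C D : Finset X} (η : C ↪ D) : Set.InjOn (extendEmb η) C := by
  intro a ha b hb h
  rw [extendEmb_of_mem η ha, extendEmb_of_mem η hb] at h
  exact congrArg Subtype.val (η.injective (Subtype.ext h))

lemma not_mem_of_mem_of_ne {C D : Finset X} (hC : C ∈ P.parts) (hD : D ∈ P.parts) (h : C ≠ D)
    {a : X} (ha : a ∈ D) : a ∉ C :=
  fun h2 => h (((mem_block hC).1 h2).symm.trans ((mem_block hD).1 ha))

lemma exists_image_eq {C D : Finset X} (hD : D.Nonempty) (h : D.card ≤ C.card) :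
    ∃ σ : X → X, C.image σ = D := by
  obtain ⟨C', hC', hcard⟩ := Finset.exists_subset_card_eq h
  let e := Finset.equivOfCardEq hcard
  obtain ⟨d, hd⟩ := hD
  refine ⟨fun a => if h : a ∈ C' then (e ⟨a, h⟩ : X) else d, ?_⟩
  ext y
  rw [mem_image]
  constructor
  · rintro ⟨a, -, rfl⟩
    split_ifs with ha
    · exact (e ⟨a, ha⟩).2
    · exact hd
  · intro hy
    refine ⟨e.symm ⟨y, hy⟩, hC' (e.symm ⟨y, hy⟩).2, ?_⟩
    rw [dif_pos (e.symm ⟨y, hy⟩).2]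
    simp

/-- `u` can stand for the index `i` in a generating set. -/
def Realizes {κ : X → ℕ} {r : Finset X → ℕ} : GenIndex P κ r → Function.End X → Prop
  | Sum.inl ⟨C, p⟩, u => SameKernel u (collapse p.1.1 p.1.2) ∧ BlockInjective P u ∧
      (C.1.card = 2 → u = collapse p.1.1 p.1.2)
  | Sum.inr (Sum.inl ⟨C, ⟨_, η⟩⟩), u => SameKernel u (moveBlock C.1 (extendEmb η))
  | Sum.inr (Sum.inr ⟨C, j⟩), u => Shrinks P C.1 j.1 u

lemma SameKernel.of_eq_apply {u m m' : Function.End X} (h : SameKernel u m)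
    (h' : SameKernel u m') {a b : X} (hab : m a = m b) : m' a = m' b :=
  (h' a b).1 ((h a b).2 hab)

lemma moveBlock_emb_eq_iff {C D : Finset X} (hC : C ∈ P.parts) (hD : D ∈ P.parts) (hCD : C ≠ D)
    (η : C ↪ D) (a b : X) : moveBlock C (extendEmb η) a = moveBlock C (extendEmb η) b ↔
      a = b ∨ (a ∈ C ∧ b = extendEmb η a) ∨ (b ∈ C ∧ a = extendEmb η b) :=
  moveBlock_eq_iff (extendEmb_injOn η)
    (fun _ hc => not_mem_of_mem_of_ne hC hD hCD (extendEmb_mem η hc)) a b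

lemma moveBlock_emb_apply_eq {C D : Finset X} (hC : C ∈ P.parts) (hD : D ∈ P.parts) (hCD : C ≠ D)
    (η : C ↪ D) {c : X} (hc : c ∈ C) :
    moveBlock C (extendEmb η) c = moveBlock C (extendEmb η) (extendEmb η c) :=
  (moveBlock_emb_eq_iff hC hD hCD η _ _).2 (Or.inr (Or.inl ⟨hc, rfl⟩))

lemma moveBlock_emb_injOn {C D B : Finset X} (hC : C ∈ P.parts) (hD : D ∈ P.parts) (hCD : C ≠ D)
    (η : C ↪ D) (hB : B ∈ P.parts) : Set.InjOn (moveBlock C (extendEmb η)) B := by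
  intro a ha b hb hab
  rcases (moveBlock_emb_eq_iff hC hD hCD η _ _).1 hab with h | ⟨h1, h2⟩ | ⟨h1, h2⟩
  · exact h
  · have := extendEmb_mem η h1
    rw [← h2] at this
    rw [SetLike.mem_coe, mem_block hB] at ha hb
    rw [mem_block hC] at h1
    rw [mem_block hD] at this
    exact absurd (h1.symm.trans (ha.trans (hb.symm.trans this))) hCD
  · have := extendEmb_mem η h1
    rw [← h2] at this
    rw [SetLike.mem_coe, mem_block hB] at ha hb
    rw [mem_block hC] at h1
    rw [mem_block hD] at this
    exact absurd (h1.symm.trans (hb.trans (ha.symm.trans this))) hCD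

variable {κ : X → ℕ} {r : Finset X → ℕ}

/-- The three kinds are separated by injectivity. Pair realizers are block-injective. Embedding
realizers merge blocks but are injective on each block. Shrinking maps merge blocks and are not
injective on one of them. Within the embedding kind, the kernel determines the embedding up to
inversion, and `r` picks the direction. -/
lemma Realizes.unique {i i' : GenIndex P κ r} {u : Function.End X} (h : Realizes i u)
    (h' : Realizes i' u) : i = i' := by
  have pairEmb : ∀ (C D : Finset X) (η : C ↪ D), C ∈ P.parts → D ∈ P.parts → C ≠ D →
      BlockInjective P u → ¬ SameKernel u (moveBlock C (extendEmb η)) := by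
    intro C D η hC hD hCD hb hk
    obtain ⟨c, hc⟩ := P.nonempty_of_mem_parts hC
    have := (hk _ _).2 (moveBlock_emb_apply_eq hC hD hCD η hc)
    have := hb _ _ (congrArg P.part this)
    rw [(mem_block hC).1 hc, (mem_block hD).1 (extendEmb_mem η hc)] at this
    exact hCD this
  have embShrink : ∀ (B C D : Finset X) (η : C ↪ D) (j : ℕ), B ∈ P.parts → C ∈ P.parts →
      D ∈ P.parts → C ≠ D →
      SameKernel u (moveBlock C (extendEmb η)) → ¬ Shrinks P B j u := by
    intro B C D η j hB hC hD hCD hk hs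
    apply hs.not_injOn
    intro a ha b hb hab
    exact moveBlock_emb_injOn hC hD hCD η hB ha hb ((hk _ _).1 hab)
  rcases i with ⟨⟨C, hC⟩, ⟨⟨x, y⟩, hp⟩⟩ | ⟨⟨C, hC⟩, ⟨⟨D, hD⟩, η⟩⟩ | ⟨⟨C, hC⟩, ⟨j, hj⟩⟩ <;>
  rcases i' with ⟨⟨C', hC'⟩, ⟨⟨x', y'⟩, hp'⟩⟩ | ⟨⟨C', hC'⟩, ⟨⟨D', hD'⟩, η'⟩⟩ |
    ⟨⟨C', hC'⟩, ⟨j', hj'⟩⟩ <;> simp only [Realizes] at h h'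
  · have hp1 := mem_filter.1 hp
    have hp1' := mem_filter.1 hp'
    rw [mem_offDiag] at hp1 hp1'
    obtain ⟨⟨hx, hy, hxy⟩, hor⟩ := hp1
    obtain ⟨⟨hx', hy', hxy'⟩, hor'⟩ := hp1'
    simp only at hx hy hxy hor hx' hy' hxy' hor'
    have h1 := h.1.of_eq_apply h'.1 ((collapse_eq_iff hxy x y).2 (by simp))
    rw [collapse_eq_iff hxy'] at h1
    rcases h1 with h1 | ⟨rfl, rfl⟩ | ⟨rfl, rfl⟩
    · exact absurd h1 hxy
    · obtain rfl : C = C' := ((mem_block hC).1 hx).symm.trans ((mem_block hC').1 hx')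
      rfl
    · obtain rfl : C = C' := ((mem_block hC).1 hx).symm.trans ((mem_block hC').1 hy')
      exfalso
      rcases hor with hor | hor
      · have h3 := (h.2.2 hor).symm.trans (h'.2.2 hor)
        have h4 := congrFun h3 x
        rw [collapse_apply, collapse_apply, if_pos rfl, if_neg hxy] at h4
        exact hxy h4.symm
      · rcases hor' with hor' | hor'
        · have h3 := (h.2.2 hor').symm.trans (h'.2.2 hor')
          have h4 := congrFun h3 x
          rw [collapse_apply, collapse_apply, if_pos rfl, if_neg hxy] at h4
          exact hxy h4.symm
        · omega
  · have hD1 := mem_filter.1 hD'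
    exact absurd h' (pairEmb _ _ _ hC' hD1.1 (by rintro rfl; exact lt_irrefl _ hD1.2) h.2.1)
  · exact absurd h.2.1 h'.not_blockInjective
  · have hD1 := mem_filter.1 hD
    exact absurd h (pairEmb _ _ _ hC hD1.1 (by rintro rfl; exact lt_irrefl _ hD1.2) h'.2.1)
  · have hD1 := mem_filter.1 hD
    have hD1' := mem_filter.1 hD'
    have hCD : C ≠ D := by rintro rfl; exact lt_irrefl _ hD1.2
    have hCD' : C' ≠ D' := by rintro rfl; exact lt_irrefl _ hD1'.2
    have key : ∀ c ∈ C, c ∈ C' ∧ extendEmb η c = extendEmb η' c := by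
      intro c hc
      have hcD := extendEmb_mem η hc
      have h1 := h.of_eq_apply h' (moveBlock_emb_apply_eq hC hD1.1 hCD η hc)
      rcases (moveBlock_emb_eq_iff hC' hD1'.1 hCD' η' _ _).1 h1 with h1 | h1 | h1
      · rw [← h1] at hcD
        exact absurd hc (not_mem_of_mem_of_ne hC hD1.1 hCD hcD)
      · exact h1
      · obtain ⟨h2, h3⟩ := h1
        have h4 := extendEmb_mem η' h2
        rw [← h3] at h4
        obtain rfl : D = C' := ((mem_block hD1.1).1 hcD).symm.trans ((mem_block hC').1 h2)
        obtain rfl : C = D' := ((mem_block hC).1 hc).symm.trans ((mem_block hD1'.1).1 h4)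
        have := hD1.2
        have := hD1'.2
        simp only at *
        omega
    obtain ⟨c, hc⟩ := P.nonempty_of_mem_parts hC
    obtain ⟨hc', he⟩ := key c hc
    obtain rfl : C = C' := ((mem_block hC).1 hc).symm.trans ((mem_block hC').1 hc')
    obtain rfl : D = D' := by
      have h1 := extendEmb_mem η hc
      have h2 := extendEmb_mem η' hc
      rw [he] at h1
      exact ((mem_block hD1.1).1 h1).symm.trans ((mem_block hD1'.1).1 h2)
    obtain rfl : η = η' := by
      ext ⟨a, ha⟩
      have := (key a ha).2
      rwa [extendEmb_of_mem η ha, extendEmb_of_mem η' ha] at this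
    rfl
  · have hD1 := mem_filter.1 hD
    exact absurd h' (embShrink _ _ _ η _ hC' hC hD1.1
      (by rintro rfl; exact lt_irrefl _ hD1.2) h)
  · exact absurd h'.2.1 h.not_blockInjective
  · have hD1 := mem_filter.1 hD'
    exact absurd h (embShrink _ _ _ η' _ hC hC' hD1.1
      (by rintro rfl; exact lt_irrefl _ hD1.2) h')
  · obtain ⟨h1, h2⟩ := h.unique hC hC' h'
    subst h1 h2
    rfl

section Generators

variable {U : Set (Function.End X)}

lemma exists_realizes (hU : Submonoid.closure U = idempotentSubmonoid P) (i : GenIndex P κ r) :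
    ∃ u ∈ U, Realizes i u := by
  rcases i with ⟨⟨C, hC⟩, ⟨⟨x, y⟩, hp⟩⟩ | ⟨⟨C, hC⟩, ⟨⟨D, hD⟩, η⟩⟩ | ⟨⟨C, hC⟩, ⟨j, hj⟩⟩ <;>
    simp only [Realizes]
  · have hp1 := mem_filter.1 hp
    rw [mem_offDiag] at hp1
    obtain ⟨⟨hx, hy, hxy⟩, hor⟩ := hp1
    simp only at hx hy hxy hor
    have hpart : P.part x = P.part y := by rw [(mem_block hC).1 hx, (mem_block hC).1 hy]
    by_cases h2 : C.card = 2
    · refine ⟨_, collapse_mem_of_card_eq_two hU hxy hpart (by rw [(mem_block hC).1 hx, h2]),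
        fun _ _ => Iff.rfl, collapse_blockInjective hpart, fun _ => rfl⟩
    · obtain ⟨u, hu, h1, h3⟩ := exists_generator_sameKernel hU (collapse_mem hpart)
        (collapse_ne_one hxy) (collapse_minimal hxy)
      exact ⟨u, hu, h1, h3 (collapse_blockInjective hpart), fun h => absurd h h2⟩
  · have hD1 := mem_filter.1 hD
    have hCD : C ≠ D := by rintro rfl; exact lt_irrefl _ hD1.2
    obtain ⟨u, hu, h1, -⟩ := exists_generator_sameKernel hU
      (moveBlock_mem hC hD1.1 hCD fun c hc => extendEmb_mem η hc) (by
        intro h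
        obtain ⟨c, hc⟩ := P.nonempty_of_mem_parts hC
        have := congrFun h c
        rw [moveBlock_of_mem _ hc, end_one_apply] at this
        have h3 := extendEmb_mem η hc
        rw [this] at h3
        exact not_mem_of_mem_of_ne hC hD1.1 hCD h3 hc)
      (moveBlock_minimal hC hD1.1 hCD (fun c hc => extendEmb_mem η hc) (extendEmb_injOn η))
    exact ⟨u, hu, h1⟩
  · obtain ⟨hj1, D, hD, rfl⟩ := mem_filter.1 hj
    have hlt := (mem_Ico.1 hj1).2
    obtain ⟨σ, hσ⟩ := exists_image_eq (P.nonempty_of_mem_parts hD) hlt.le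
    exact exists_generator_shrinks hU hC hD hlt hσ

lemma exists_realizing_injection (hU : Submonoid.closure U = idempotentSubmonoid P) :
    ∃ f : GenIndex P κ r → Function.End X, Function.Injective f ∧ (∀ i, f i ∈ U) ∧
      ∀ i, Realizes i (f i) := by
  choose f hf1 hf2 using exists_realizes (κ := κ) (r := r) hU
  refine ⟨f, fun i j hij => ?_, hf1, hf2⟩
  have := hf2 j
  rw [← hij] at this
  exact (hf2 i).unique this

lemma encard_range_genIndex {f : GenIndex P κ r → Function.End X} (hf : Function.Injective f) :
    (Set.range f).encard = Fintype.card (GenIndex P κ r) := by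
  rw [← Set.image_univ, hf.encard_image, Set.encard_univ, ENat.card_eq_coe_fintype_card]

lemma card_genIndex_le_encard (hU : Submonoid.closure U = idempotentSubmonoid P) :
    (Fintype.card (GenIndex P κ r) : ℕ∞) ≤ U.encard := by
  obtain ⟨f, hf, hfU, -⟩ := exists_realizing_injection (κ := κ) (r := r) hU
  rw [← encard_range_genIndex hf]
  exact Set.encard_le_encard (Set.range_subset_iff.2 hfU)

/-- If `{c}` and `{d}` are the only singleton blocks, every generating set of idempotents contains
the map `c ↦ d`. -/
lemma collapse_mem_of_two_singletons (hU : Submonoid.closure U = idempotentSubmonoid P)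
    (hid : U ⊆ idempotentSet P) {c d : X} (hcd : c ≠ d)
    (hd : P.part d = {d})
    (honly : ∀ x, P.part x = {x} → x = c ∨ x = d) (hm : collapse c d ∈ idempotentSet P) :
    collapse c d ∈ U := by
  have hmU : collapse c d ∈ Submonoid.closure U := hU ▸ Submonoid.subset_closure hm
  -- The generator that leads out of these two maps turns out to be `collapse c d` itself.
  let p : Function.End X → Prop := fun f => f = 1 ∨ f = collapse d c
  have hne : collapse c d ≠ collapse d c := by
    intro h
    have := congrFun h c
    rw [collapse_apply, collapse_apply, if_pos rfl, if_neg hcd] at this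
    exact hcd this.symm
  have hpn : ¬ p (collapse c d * 1) := by
    rw [mul_one]
    rintro (h | h)
    · exact collapse_ne_one hcd h
    · exact hne h
  obtain ⟨g, hg, u, hu, h, hh, hmu, hph, hpu⟩ := exists_first_exit p (Or.inl rfl) hmU hpn
  rw [mul_one] at hph hpu
  have huid := idempotent_apply (hid hu)
  rcases hph with rfl | rfl
  · rw [mul_one] at hpu hmu
    have hker : ∀ a b, u a = u b → a = b ∨ (a = c ∧ b = d) ∨ (a = d ∧ b = c) := by
      intro a b hab
      rw [← collapse_eq_iff hcd, hmu]
      exact congrArg g hab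
    have hoff : ∀ z, z ≠ c → z ≠ d → u z = z := by
      intro z hzc hzd
      rcases hker _ _ (huid z) with h | h | h
      · exact h
      · exact absurd h.2 hzd
      · exact absurd h.2 hzc
    have hu1 : u ≠ 1 := fun h => hpu (Or.inl h)
    have hk := sameKernel_of_minimal (collapse_minimal hcd)
      (hU ▸ Submonoid.subset_closure hu) hu1 (fun a b hab => by
        rw [hmu]; exact congrArg g hab)
    have hcd' : u c = u d := (hk c d).2 ((collapse_eq_iff hcd _ _).2 (by simp))
    have hval : u c = c ∨ u c = d := by
      rcases hker _ _ (huid c) with h | h | h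
      · exact Or.inl h
      · exact absurd h.2 hcd
      · exact Or.inr h.1
    rcases hval with hv | hv
    · exfalso
      apply hpu
      right
      funext a
      rw [collapse_apply]
      split_ifs with ha
      · rw [ha, ← hcd', hv]
      · by_cases hac : a = c
        · rw [hac, hv]
        · exact hoff a hac ha
    · have : u = collapse c d := by
        funext a
        rw [collapse_apply]
        split_ifs with ha
        · rw [ha, hv]
        · by_cases hac : a = d
          · rw [hac, ← hcd', hv]
          · exact hoff a ha hac
      exact this ▸ hu
  -- Here c and d are already identified, so u is injective off d. An idempotent of this kind moves
  -- a point other than d only to d. The whole block of that point then lands in {d}, so it is a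
  -- singleton and the point is c.
  · have hinj : ∀ a b, a ≠ d → b ≠ d → u a = u b → a = b := by
      intro a b ha hb hab
      have h1 : collapse c d a = collapse c d b := by
        rw [hmu]
        apply congrArg g
        rw [end_mul_apply, end_mul_apply, collapse_apply, collapse_apply, if_neg ha, if_neg hb,
          hab]
      rw [collapse_eq_iff hcd] at h1
      tauto
    have hmoved : ∀ x, x ≠ d → u x ≠ x → u x = d ∧ x = c := by
      intro x hxd hx
      have hux : u x = d := by
        by_contra h
        exact hx (hinj _ _ h hxd (huid x))
      refine ⟨hux, (honly x ?_).resolve_right hxd⟩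
      rw [Finset.eq_singleton_iff_unique_mem]
      refine ⟨mem_part_univ x, fun y hy => ?_⟩
      have hyx : P.part y = P.part x := (mem_block (part_mem_parts x)).1 hy
      have huy : u y = d := by
        have h1 := mem_transformations.1 (hid hu).1 _ _ hyx
        rw [hux, hd] at h1
        have h2 := mem_part_univ (P := P) (u y)
        rwa [h1, mem_singleton] at h2
      refine hinj _ _ ?_ hxd (huy.trans hux.symm)
      rintro rfl
      have h2 := mem_part_univ (P := P) x
      rw [← hyx, hd, mem_singleton] at h2
      exact hxd h2
    have huc : u c = d := by
      by_contra hn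
      apply hpu
      right
      funext a
      rw [end_mul_apply]
      have hb : collapse d c a ≠ d := by
        rw [collapse_apply]
        split_ifs with h
        · exact hcd
        · exact h
      by_contra hx
      have := hmoved _ hb hx
      rw [this.2] at this
      exact hn this.1
    have : u = collapse c d := by
      funext a
      rw [collapse_apply]
      split_ifs with ha
      · rw [ha, huc]
      · by_cases had : a = d
        · rw [had, ← huc, huid]
        · by_contra hx
          exact ha (hmoved a had hx).2
    exact this ▸ hu

lemma collapse_eq_moveBlock {c d : X} (η : ({c} : Finset X) ↪ ({d} : Finset X)) :
    moveBlock {c} (extendEmb η) = collapse c d := by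
  funext a
  rw [moveBlock_apply, collapse_apply]
  by_cases ha : a = c
  · subst ha
    rw [if_pos (mem_singleton_self _), if_pos rfl]
    exact mem_singleton.1 (extendEmb_mem η (mem_singleton_self a))
  · rw [if_neg (by rwa [mem_singleton]), if_neg ha]

/-- Both collapses between the two singletons lie in U but realize the same index, so any injective
choice of realizers misses one of them. -/
lemma card_genIndex_succ_le_encard (hU : Submonoid.closure U = idempotentSubmonoid P)
    (hid : U ⊆ idempotentSet P) (hr : Function.Injective r) (h2 : P.blockCount 1 = 2) :
    (Fintype.card (GenIndex P κ r) : ℕ∞) + 1 ≤ U.encard := by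
  obtain ⟨C, D, hCD, hset⟩ := card_eq_two.1 h2
  have hC := mem_filter.1 (hset ▸ mem_insert_self C {D} : C ∈ P.parts.filter fun C => C.card = 1)
  have hD := mem_filter.1
    (hset ▸ mem_insert_of_mem (mem_singleton_self D) : D ∈ P.parts.filter fun C => C.card = 1)
  wlog hlt : r C < r D generalizing C D
  · exact this D C hCD.symm (by rw [hset, pair_comm]) hD hC
      (lt_of_le_of_ne (not_lt.1 hlt) fun h => hCD (hr h).symm)
  obtain ⟨c, rfl⟩ := card_eq_one.1 hC.2
  obtain ⟨d, rfl⟩ := card_eq_one.1 hD.2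
  have hcd : c ≠ d := fun h => hCD (by rw [h])
  have hpc : P.part c = {c} := (mem_block hC.1).1 (mem_singleton_self c)
  have hpd : P.part d = {d} := (mem_block hD.1).1 (mem_singleton_self d)
  have honly : ∀ x, P.part x = {x} → x = c ∨ x = d := by
    intro x hx
    have : ({x} : Finset X) ∈ P.parts.filter fun C => C.card = 1 :=
      mem_filter.2 ⟨hx ▸ part_mem_parts x, card_singleton x⟩
    rw [hset, mem_insert, mem_singleton, singleton_inj, singleton_inj] at this
    exact this
  let η : ({c} : Finset X) ↪ ({d} : Finset X) :=
    ⟨fun _ => ⟨d, mem_singleton_self d⟩, fun a b _ => Subsingleton.elim a b⟩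
  let η' : ({d} : Finset X) ↪ ({c} : Finset X) :=
    ⟨fun _ => ⟨c, mem_singleton_self c⟩, fun a b _ => Subsingleton.elim a b⟩
  have hm1 : collapse c d ∈ idempotentSet P := collapse_eq_moveBlock η ▸
    moveBlock_mem hC.1 hD.1 hCD fun c hc => extendEmb_mem η hc
  have hm2 : collapse d c ∈ idempotentSet P := collapse_eq_moveBlock η' ▸
    moveBlock_mem hD.1 hC.1 hCD.symm fun c hc => extendEmb_mem η' hc
  have hu1 := collapse_mem_of_two_singletons hU hid hcd hpd honly hm1
  have hu2 := collapse_mem_of_two_singletons hU hid hcd.symm hpc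
    (fun x hx => (honly x hx).symm) hm2
  have hne : collapse c d ≠ collapse d c := by
    intro h
    have := congrFun h c
    rw [collapse_apply, collapse_apply, if_pos rfl, if_neg hcd] at this
    exact hcd this.symm
  obtain ⟨f, hf, hfU, hfr⟩ := exists_realizing_injection (κ := κ) (r := r) hU
  let i₀ : GenIndex P κ r := Sum.inr (Sum.inl ⟨⟨{c}, hC.1⟩, ⟨⟨{d}, mem_filter.2 ⟨hD.1, hlt⟩⟩, η⟩⟩)
  have hr1 : Realizes i₀ (collapse c d) := by
    simp only [i₀, Realizes]
    rw [collapse_eq_moveBlock]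
    exact fun _ _ => Iff.rfl
  have hr2 : Realizes i₀ (collapse d c) := by
    simp only [i₀, Realizes]
    rw [collapse_eq_moveBlock]
    intro a b
    rw [collapse_eq_iff hcd, collapse_eq_iff hcd.symm]
    tauto
  obtain ⟨u, hu, huf⟩ : ∃ u ∈ U, u ∉ Set.range f := by
    by_cases h : f i₀ = collapse c d
    · refine ⟨_, hu2, ?_⟩
      rintro ⟨i, hi⟩
      have := (hi ▸ hfr i).unique hr2
      rw [this, h] at hi
      exact hne hi
    · refine ⟨_, hu1, ?_⟩
      rintro ⟨i, hi⟩
      have := (hi ▸ hfr i).unique hr1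
      rw [this] at hi
      exact h hi
  rw [← encard_range_genIndex hf, ← Set.encard_insert_of_notMem huf]
  exact Set.encard_le_encard (Set.insert_subset hu (Set.range_subset_iff.2 hfU))

end Generators

end PartitionRank

/-! ### The upper bound -/

namespace PartitionRank

open Finset

variable {X : Type*} [Fintype X] [DecidableEq X] {P : Finpartition (Finset.univ : Finset X)}

lemma moveBlock_congr {C : Finset X} {σ η : X → X} (h : ∀ a ∈ C, σ a = η a) :
    moveBlock C σ = moveBlock C η := by
  funext a
  rw [moveBlock_apply, moveBlock_apply]
  split_ifs with ha
  · exact h a ha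
  · rfl

/-! ### Rearranging the values on one block -/

section Reach

variable {K : Submonoid (Function.End X)} {C : Finset X}

/-- Precomposing with `collapse x y` copies the value at y into position x. This is the only move
used below. -/
lemma moveBlock_update_mem (hK : ∀ x ∈ C, ∀ y ∈ C, x ≠ y → collapse x y ∈ K) {σ : X → X}
    (hσ : moveBlock C σ ∈ K) {x y : X} (hx : x ∈ C) (hy : y ∈ C) :
    moveBlock C (Function.update σ x (σ y)) ∈ K := by
  by_cases hxy : x = y
  · subst hxy
    rwa [Function.update_eq_self]
  · have : moveBlock C (Function.update σ x (σ y)) = moveBlock C σ * collapse x y := by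
      funext a
      rw [end_mul_apply, collapse_apply]
      split_ifs with ha
      · rw [ha, moveBlock_of_mem _ hx, moveBlock_of_mem _ hy, Function.update_self]
      · rw [moveBlock_apply, moveBlock_apply, Function.update_of_ne ha]
    rw [this]
    exact mul_mem hσ (hK x hx y hy hxy)

/-- Two values of a map that takes some value twice can be swapped, using the repeated value as
spare room. -/
lemma moveBlock_swap_mem (hK : ∀ x ∈ C, ∀ y ∈ C, x ≠ y → collapse x y ∈ K) {σ : X → X}
    (hσ : moveBlock C σ ∈ K) (hn : ¬ Set.InjOn σ C) {x y : X} (hx : x ∈ C) (hy : y ∈ C) :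
    moveBlock C (σ ∘ Equiv.swap x y) ∈ K := by
  simp only [Set.InjOn, not_forall] at hn
  obtain ⟨a, ha, b, hb, hab, hne⟩ := hn
  rw [SetLike.mem_coe] at ha hb
  have hcopy := fun {σ : X → X} (hσ : moveBlock C σ ∈ K) {x y : X} (hx : x ∈ C) (hy : y ∈ C) =>
    moveBlock_update_mem hK hσ hx hy
  by_cases hxy : x = y
  · subst hxy
    simpa using hσ
  -- Position b serves as temporary storage: copy x to b, y to x, b to y. Its old value is then
  -- restored from a; when x = a it is already back.
  have main : ∀ x y a b, x ∈ C → y ∈ C → a ∈ C → b ∈ C → a ≠ b → σ a = σ b → x ≠ y →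
      y ≠ a → y ≠ b → x ≠ b → moveBlock C (σ ∘ Equiv.swap x y) ∈ K := by
    intro x y a b hx hy ha hb hab hσab hxy hya hyb hxb
    have h1 := hcopy hσ hb hx
    have h2 := hcopy h1 hx hy
    have h3 := hcopy h2 hy hb
    by_cases hxa : x = a
    · have : moveBlock C (σ ∘ Equiv.swap x y)
          = moveBlock C (Function.update (Function.update (Function.update σ b (σ x)) x
            (Function.update σ b (σ x) y)) y (Function.update (Function.update σ b (σ x)) x
            (Function.update σ b (σ x) y) b)) := by
        apply moveBlock_congr
        intro c _
        simp only [Function.comp_apply, Function.update_apply, Equiv.swap_apply_def]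
        grind
      rw [this]
      exact h3
    · have h4 := hcopy h3 hb ha
      refine (congrArg (· ∈ K) (moveBlock_congr ?_)).mp h4
      intro c _
      simp only [Function.comp_apply, Function.update_apply, Equiv.swap_apply_def]
      grind
  by_cases h1 : y = a
  · by_cases h2 : x = b
    · rw [show σ ∘ Equiv.swap x y = σ by
        subst h1 h2
        funext c
        simp only [Function.comp_apply, Equiv.swap_apply_def]
        grind]
      exact hσ
    · rw [Equiv.swap_comm]
      exact main y x a b hy hx ha hb hne hab (Ne.symm hxy) (by grind) (by grind) (by grind)
  · by_cases h2 : y = b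
    · by_cases h3 : x = a
      · rw [show σ ∘ Equiv.swap x y = σ by
          subst h2 h3
          funext c
          simp only [Function.comp_apply, Equiv.swap_apply_def]
          grind]
        exact hσ
      · rw [Equiv.swap_comm]
        exact main y x b a hy hx hb ha (Ne.symm hne) hab.symm (Ne.symm hxy) (by grind) (by grind)
          (by grind)
    · by_cases h3 : x = b
      · exact main x y b a hx hy hb ha (Ne.symm hne) hab.symm hxy (by grind) (by grind) (by grind)
      · exact main x y a b hx hy ha hb hne hab hxy h1 h2 h3

/-- From a non-injective map on `C`, all maps on `C` with values in its image are reached. -/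
lemma moveBlock_mem_of_image_subset (hK : ∀ x ∈ C, ∀ y ∈ C, x ≠ y → collapse x y ∈ K)
    {σ η : X → X} (hσ : moveBlock C σ ∈ K) (hn : ¬ Set.InjOn σ C)
    (hsub : C.image η ⊆ C.image σ) : moveBlock C η ∈ K := by
  induction h : (C.filter fun x => σ x ≠ η x).card using Nat.strong_induction_on generalizing σ with
  | _ n ih =>
  subst h
  have hswapn : ∀ x ∈ C, ∀ y ∈ C, ¬ Set.InjOn (σ ∘ Equiv.swap x y) C := by
    intro x hx y hy hi
    apply hn
    have hmaps : ∀ a ∈ C, Equiv.swap x y a ∈ C := by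
      intro a ha
      rw [Equiv.swap_apply_def]
      split_ifs <;> assumption
    intro a ha b hb hab
    apply (Equiv.swap x y).injective
    apply hi (hmaps a ha) (hmaps b hb)
    simpa using hab
  have hswapimg : ∀ x ∈ C, ∀ y ∈ C, C.image η ⊆ C.image (σ ∘ Equiv.swap x y) := by
    intro x hx y hy z hz
    obtain ⟨a, ha, rfl⟩ := mem_image.1 (hsub hz)
    refine mem_image.2 ⟨Equiv.swap x y a, ?_, by simp⟩
    rw [Equiv.swap_apply_def]
    split_ifs <;> assumption
  have hswaplt : ∀ x ∈ C, ∀ y ∈ C, x ≠ y → σ y = η x → σ x ≠ η x → σ y ≠ η y →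
      (C.filter fun z => (σ ∘ Equiv.swap x y) z ≠ η z).card
        < (C.filter fun z => σ z ≠ η z).card := by
    intro x hx y hy hxy h1 h2 h3
    apply card_lt_card
    rw [Finset.ssubset_iff_of_subset]
    · refine ⟨x, mem_filter.2 ⟨hx, h2⟩, ?_⟩
      simp [h1]
    · intro z hz
      rw [mem_filter] at hz ⊢
      refine ⟨hz.1, ?_⟩
      have := hz.2
      rw [Function.comp_apply, Equiv.swap_apply_def] at this
      split_ifs at this with h4 h5
      · rwa [h4]
      · rwa [h5]
      · exact this
  by_cases hall : ∀ x ∈ C, σ x = η x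
  · rwa [← moveBlock_congr hall]
  push Not at hall
  obtain ⟨x, hx, hxne⟩ := hall
  obtain ⟨y, hy, hyx⟩ := mem_image.1 (hsub (mem_image_of_mem η hx))
  have hxy : x ≠ y := by rintro rfl; exact hxne hyx
  -- Every move must lower the number of wrong positions without losing a needed value. A swap puts
  -- one wrong position right and cannot spoil a correct one, as both swapped positions are wrong.
  by_cases hyy : σ y = η y
  · by_cases hz : ∃ z ∈ C, z ≠ x ∧ σ z ≠ η z ∧ η z = σ x
    · obtain ⟨z, hz, hzx, hz1, hz2⟩ := hz
      exact ih _ (hswaplt z hz x hx hzx hz2.symm hz1 hxne)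
        (moveBlock_swap_mem hK hσ hn hz hx) (hswapn z hz x hx) (hswapimg z hz x hx) rfl
    -- No other wrong position wants `σ x`, so overwriting it is safe: if η takes that value, it
    -- does so at a position that is already correct.
    · push Not at hz
      refine ih _ ?_ (moveBlock_update_mem hK hσ hx hy) ?_ ?_ rfl
      · apply card_lt_card
        rw [Finset.ssubset_iff_of_subset]
        · refine ⟨x, mem_filter.2 ⟨hx, hxne⟩, ?_⟩
          simp [hyx]
        · intro z hz
          rw [mem_filter] at hz ⊢
          refine ⟨hz.1, ?_⟩
          have := hz.2
          rw [Function.update_apply] at this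
          split_ifs at this with h4
          · rwa [h4]
          · exact this
      · intro hi
        apply hxy
        apply hi hx hy
        rw [Function.update_self, Function.update_of_ne hxy.symm]
      · intro v hv
        obtain ⟨a, ha, rfl⟩ := mem_image.1 (hsub hv)
        by_cases hax : a = x
        · subst hax
          obtain ⟨z, hzC, hzv⟩ := mem_image.1 hv
          have hza : z ≠ a := by rintro rfl; exact hxne hzv.symm
          have hzz : σ z = η z := by
            by_contra hzz
            exact hz z hzC hza hzz hzv
          exact mem_image.2 ⟨z, hzC, by rw [Function.update_of_ne hza, hzz, hzv]⟩
        · exact mem_image.2 ⟨a, ha, by rw [Function.update_of_ne hax]⟩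
  · exact ih _ (hswaplt x hx y hy hxy hyx hxne hyy)
      (moveBlock_swap_mem hK hσ hn hx hy) (hswapn x hx y hy) (hswapimg x hx y hy) rfl

end Reach

/-! ### From elementary moves to all idempotents -/

section Generate

variable {K : Submonoid (Function.End X)}

/-- For a non-injective η, enlarge its image to a |C|-element subset of D, embed C onto that set,
and overwrite one value outside the image of η. This gives a non-injective map whose image still
contains that of η. -/
lemma moveBlock_mem_of_card_le
    (h1 : ∀ x y, x ≠ y → P.part x = P.part y → collapse x y ∈ K)
    (h2 : ∀ C ∈ P.parts, ∀ D ∈ P.parts, C ≠ D → ∀ η : X → X, (∀ c ∈ C, η c ∈ D) →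
      Set.InjOn η C → moveBlock C η ∈ K)
    {C D : Finset X} (hC : C ∈ P.parts) (hD : D ∈ P.parts) (hCD : C ≠ D)
    (hle : C.card ≤ D.card) {η : X → X} (hη : ∀ c ∈ C, η c ∈ D) : moveBlock C η ∈ K := by
  have hK : ∀ x ∈ C, ∀ y ∈ C, x ≠ y → collapse x y ∈ K := fun x hx y hy hxy =>
    h1 x y hxy (((mem_block hC).1 hx).trans ((mem_block hC).1 hy).symm)
  by_cases hi : Set.InjOn η C
  · exact h2 C hC D hD hCD η hη hi
  have hR : (C.image η).card < C.card := by
    refine lt_of_le_of_ne card_image_le fun h => hi (card_image_iff.1 h)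
  have hRD : C.image η ⊆ D := by
    intro z hz
    obtain ⟨c, hc, rfl⟩ := mem_image.1 hz
    exact hη c hc
  obtain ⟨R, hR1, hR2, hRc⟩ := exists_subsuperset_card_eq hRD hR.le hle
  have hCne := P.nonempty_of_mem_parts hC
  have hRpos : 0 < R.card := hRc ▸ hCne.card_pos
  obtain ⟨ι, hι⟩ := exists_image_eq (C := C) (card_pos.1 hRpos) hRc.le
  have hιi : Set.InjOn ι C := card_image_iff.1 (by rw [hι, hRc])
  have hιK : moveBlock C ι ∈ K := h2 C hC D hD hCD ι
    (fun c hc => hR2 (hι ▸ mem_image_of_mem ι hc)) hιi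
  obtain ⟨y, hyR, hy⟩ := exists_mem_notMem_of_card_lt_card (hRc ▸ hR)
  rw [← hι] at hyR
  obtain ⟨a, ha, rfl⟩ := mem_image.1 hyR
  have h2C : 1 < C.card := lt_of_le_of_lt (hCne.image η).card_pos hR
  obtain ⟨b, hb, hba⟩ := exists_mem_ne h2C a
  refine moveBlock_mem_of_image_subset hK (moveBlock_update_mem hK hιK ha hb) ?_ ?_
  · intro h
    apply hba
    apply h hb ha
    rw [Function.update_self, Function.update_of_ne hba]
  · intro z hz
    obtain ⟨c, hc, rfl⟩ := mem_image.1 (hι ▸ hR1 hz)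
    have hca : c ≠ a := by rintro rfl; exact hy hz
    exact mem_image.2 ⟨c, hc, by rw [Function.update_of_ne hca]⟩

/-- A surjection onto a block can be redirected to another block of the same size. -/
lemma exists_redirect
    (h2 : ∀ C ∈ P.parts, ∀ D ∈ P.parts, C ≠ D → ∀ η : X → X, (∀ c ∈ C, η c ∈ D) →
      Set.InjOn η C → moveBlock C η ∈ K)
    {C D D' : Finset X} (hC : C ∈ P.parts) (hD : D ∈ P.parts) (hD' : D' ∈ P.parts)
    (hCD : C ≠ D) (hCD' : C ≠ D') (hDD' : D ≠ D') (hcard : D.card = D'.card)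
    {σ : X → X} (hσ : C.image σ = D') (hσK : moveBlock C σ ∈ K) :
    ∃ τ : X → X, C.image τ = D ∧ moveBlock C τ ∈ K := by
  let e := Finset.equivOfCardEq hcard
  set θ := extendEmb e.toEmbedding with hθ
  set θ' := extendEmb e.symm.toEmbedding with hθ'
  have m1 : ∀ d ∈ D, θ d ∈ D' := fun d hd => extendEmb_mem _ hd
  have m2 : ∀ d ∈ D', θ' d ∈ D := fun d hd => extendEmb_mem _ hd
  have i1 : ∀ d ∈ D, θ' (θ d) = d := by
    intro d hd
    rw [hθ, hθ', extendEmb_of_mem _ hd, extendEmb_of_mem _ (Subtype.prop _)]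
    simp
  have i2 : ∀ d ∈ D', θ (θ' d) = d := by
    intro d hd
    rw [hθ, hθ', extendEmb_of_mem e.symm.toEmbedding hd, extendEmb_of_mem _ (Subtype.prop _)]
    simp
  have hs : ∀ d ∈ D', ∃ c ∈ C, σ c = d := fun d hd => mem_image.1 (hσ ▸ hd)
  choose! s hsC hs using hs
  have hσD : ∀ c ∈ C, σ c ∈ D' := fun c hc => hσ ▸ mem_image_of_mem σ hc
  have k1 : moveBlock D (s ∘ θ) ∈ K := by
    refine h2 D hD C hC hCD.symm _ (fun d hd => hsC _ (m1 d hd)) ?_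
    intro a ha b hb hab
    have := congrArg σ hab
    simp only [Function.comp_apply] at this
    rw [hs _ (m1 a ha), hs _ (m1 b hb)] at this
    rw [← i1 a ha, this, i1 b hb]
  have k2 : moveBlock D' θ' ∈ K := by
    refine h2 D' hD' D hD hDD'.symm _ m2 ?_
    intro a ha b hb hab
    rw [← i2 a ha, hab, i2 b hb]
  -- With C as intermediate room, W exchanges D and D' along θ and acts as σ on C. Its square
  -- therefore fixes D and D' and sends C onto D.
  set W : Function.End X := moveBlock C σ * (moveBlock D' θ' * moveBlock D (s ∘ θ)) with hW
  have hWK : W ∈ K := mul_mem hσK (mul_mem k2 k1)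
  have nCD := fun a => not_mem_of_mem_of_ne (a := a) hC hD hCD
  have nCD' := fun a => not_mem_of_mem_of_ne (a := a) hC hD' hCD'
  have nDC := fun a => not_mem_of_mem_of_ne (a := a) hD hC hCD.symm
  have nD'C := fun a => not_mem_of_mem_of_ne (a := a) hD' hC hCD'.symm
  have nDD' := fun a => not_mem_of_mem_of_ne (a := a) hD hD' hDD'
  have wC : ∀ a ∈ C, W a = σ a := by
    intro a ha
    rw [hW, end_mul_apply, end_mul_apply, moveBlock_of_notMem _ (nDC a ha),
      moveBlock_of_notMem _ (nD'C a ha), moveBlock_of_mem _ ha]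
  have wD : ∀ a ∈ D, W a = θ a := by
    intro a ha
    have h := hsC _ (m1 a ha)
    rw [hW, end_mul_apply, end_mul_apply, moveBlock_of_mem _ ha, Function.comp_apply,
      moveBlock_of_notMem _ (nD'C _ h), moveBlock_of_mem _ h, hs _ (m1 a ha)]
  have wD' : ∀ a ∈ D', W a = θ' a := by
    intro a ha
    rw [hW, end_mul_apply, end_mul_apply, moveBlock_of_notMem _ (nDD' a ha),
      moveBlock_of_mem _ ha, moveBlock_of_notMem _ (nCD _ (m2 a ha))]
  refine ⟨θ' ∘ σ, ?_, ?_⟩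
  · rw [← image_image, hσ]
    ext d
    rw [mem_image]
    constructor
    · rintro ⟨a, ha, rfl⟩
      exact m2 a ha
    · intro hd
      exact ⟨θ d, m1 d hd, i1 d hd⟩
  · have : moveBlock C (θ' ∘ σ) = W * W := by
      funext a
      rw [end_mul_apply]
      by_cases ha : a ∈ C
      · rw [moveBlock_of_mem _ ha, wC a ha, wD' _ (hσD a ha)]; rfl
      rw [moveBlock_of_notMem _ ha]
      by_cases hb : a ∈ D
      · rw [wD a hb, wD' _ (m1 a hb), i1 a hb]
      by_cases hc : a ∈ D'
      · rw [wD' a hc, wD _ (m2 a hc), i2 a hc]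
      have : W a = a := by
        rw [hW, end_mul_apply, end_mul_apply, moveBlock_of_notMem _ hb,
          moveBlock_of_notMem _ hc, moveBlock_of_notMem _ ha]
      rw [this, this]
    rw [this]
    exact mul_mem hWK hWK

lemma moveBlock_mem_of_forall
    (h1 : ∀ x y, x ≠ y → P.part x = P.part y → collapse x y ∈ K)
    (h2 : ∀ C ∈ P.parts, ∀ D ∈ P.parts, C ≠ D → ∀ η : X → X, (∀ c ∈ C, η c ∈ D) →
      Set.InjOn η C → moveBlock C η ∈ K)
    (h3 : ∀ C ∈ P.parts, ∀ D ∈ P.parts, D.card < C.card → ∃ D' ∈ P.parts, D'.card = D.card ∧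
      ∃ σ : X → X, C.image σ = D' ∧ moveBlock C σ ∈ K)
    {C D : Finset X} (hC : C ∈ P.parts) (hD : D ∈ P.parts) (hCD : C ≠ D)
    {η : X → X} (hη : ∀ c ∈ C, η c ∈ D) : moveBlock C η ∈ K := by
  rcases le_or_gt C.card D.card with hle | hlt
  · exact moveBlock_mem_of_card_le h1 h2 hC hD hCD hle hη
  have hK : ∀ x ∈ C, ∀ y ∈ C, x ≠ y → collapse x y ∈ K := fun x hx y hy hxy =>
    h1 x y hxy (((mem_block hC).1 hx).trans ((mem_block hC).1 hy).symm)
  obtain ⟨τ, hτ, hτK⟩ : ∃ τ : X → X, C.image τ = D ∧ moveBlock C τ ∈ K := by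
    obtain ⟨D', hD', hcard, σ, hσ, hσK⟩ := h3 C hC D hD hlt
    by_cases hDD' : D = D'
    · exact ⟨σ, hDD' ▸ hσ, hσK⟩
    · exact exists_redirect h2 hC hD hD' hCD (by rintro rfl; omega) hDD' hcard.symm hσ hσK
  refine moveBlock_mem_of_image_subset hK hτK ?_ ?_
  · intro hi
    rw [← card_image_iff, hτ] at hi
    omega
  · rw [hτ]
    intro z hz
    obtain ⟨c, hc, rfl⟩ := mem_image.1 hz
    exact hη c hc

/-- A point moved by an idempotent is not a value of it, so moved points can be split off one at a
time as collapses. -/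
lemma idempotent_mem_of_part_eq
    (h1 : ∀ x y, x ≠ y → P.part x = P.part y → collapse x y ∈ K) {e : Function.End X}
    (he : ∀ a, e (e a) = e a) (hp : ∀ a, P.part (e a) = P.part a) : e ∈ K := by
  induction h : {x | e x ≠ x}.ncard using Nat.strong_induction_on
    generalizing e with
  | _ n ih =>
  subst h
  by_cases hall : e = 1
  · rw [hall]; exact one_mem K
  obtain ⟨x, hx⟩ := end_ne_one hall
  let e' : Function.End X := fun a => if a = x then x else e a
  have e'_apply : ∀ a, e' a = if a = x then x else e a := fun _ => rfl
  have hmul : e = e' * collapse x (e x) := by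
    funext a
    rw [end_mul_apply, collapse_apply]
    split_ifs with ha
    · rw [ha, e'_apply, if_neg hx, he]
    · rw [e'_apply, if_neg ha]
  have hnx : ∀ a, e a ≠ x := by
    intro a h
    apply hx
    rw [← h, he]
  rw [hmul]
  refine mul_mem (ih _ ?_ ?_ ?_ rfl) (h1 x (e x) (Ne.symm hx) (hp x).symm)
  · refine Set.ncard_lt_ncard ?_ (Set.toFinite _)
    rw [Set.ssubset_iff_of_subset]
    · exact ⟨x, hx, by simp [e'_apply]⟩
    · intro a ha
      rw [Set.mem_ofPred_eq, e'_apply] at ha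
      split_ifs at ha with h
      · exact absurd h.symm ha
      · exact ha
  · intro a
    by_cases ha : a = x
    · simp [e'_apply, ha]
    · rw [e'_apply a, if_neg ha, e'_apply, if_neg (hnx a), he]
  · intro a
    rw [e'_apply]
    split_ifs with ha
    · rw [ha]
    · exact hp a

/-- The same peeling on blocks: a block moved by e contains no value of e, so its move splits off on
the right. What remains is an idempotent that moves fewer points to other blocks, and finally one
that preserves all blocks. -/
lemma idempotentSubmonoid_le_of_forall
    (h1 : ∀ x y, x ≠ y → P.part x = P.part y → collapse x y ∈ K)
    (h2 : ∀ C ∈ P.parts, ∀ D ∈ P.parts, C ≠ D → ∀ η : X → X, (∀ c ∈ C, η c ∈ D) →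
      Set.InjOn η C → moveBlock C η ∈ K)
    (h3 : ∀ C ∈ P.parts, ∀ D ∈ P.parts, D.card < C.card → ∃ D' ∈ P.parts, D'.card = D.card ∧
      ∃ σ : X → X, C.image σ = D' ∧ moveBlock C σ ∈ K) : idempotentSubmonoid P ≤ K := by
  refine Submonoid.closure_le.2 ?_
  intro e he
  rw [SetLike.mem_coe]
  induction h : (univ.filter fun x => P.part (e x) ≠ P.part x).card
    using Nat.strong_induction_on generalizing e with
  | _ n ih =>
  subst h
  by_cases hall : ∀ a, P.part (e a) = P.part a
  · exact idempotent_mem_of_part_eq h1 (idempotent_apply he) hall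
  push Not at hall
  obtain ⟨x, hx⟩ := hall
  have heT := mem_transformations.1 he.1
  have hee := idempotent_apply he
  let e' : Function.End X := fun a => if a ∈ P.part x then a else e a
  have e'_apply : ∀ a, e' a = if a ∈ P.part x then a else e a := fun _ => rfl
  have hmem : ∀ a, a ∈ P.part x ↔ P.part a = P.part x := fun a => mem_block (part_mem_parts x)
  have hnx : ∀ a, e a ∉ P.part x := by
    intro a h
    rw [hmem] at h
    apply hx
    rw [← h, ← heT _ _ h, hee]
  have hmul : e = e' * moveBlock (P.part x) (fun a => e a) := by
    funext a
    rw [end_mul_apply, moveBlock_apply]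
    split_ifs with ha
    · rw [e'_apply, if_neg (hnx a), hee]
    · rw [e'_apply, if_neg ha]
  rw [hmul]
  refine mul_mem (ih _ ?_ ⟨mem_transformations.2 ?_, ?_⟩ rfl)
    (moveBlock_mem_of_forall h1 h2 h3 (part_mem_parts x) (part_mem_parts (e x)) (Ne.symm hx) ?_)
  · apply card_lt_card
    rw [Finset.ssubset_iff_of_subset]
    · refine ⟨x, by simp [hx], ?_⟩
      rw [mem_filter, e'_apply, if_pos (mem_part_univ x)]
      simp
    · intro a ha
      rw [mem_filter, e'_apply] at ha
      rw [mem_filter]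
      refine ⟨mem_univ _, ?_⟩
      have := ha.2
      split_ifs at this with h
      · exact absurd rfl this
      · exact this
  · intro a b hab
    by_cases ha : a ∈ P.part x
    · have hb : b ∈ P.part x := by rw [hmem] at ha ⊢; rw [← hab, ha]
      rw [e'_apply, e'_apply, if_pos ha, if_pos hb, hab]
    · have hb : b ∉ P.part x := by rw [hmem] at ha ⊢; rwa [← hab]
      rw [e'_apply, e'_apply, if_neg ha, if_neg hb, heT _ _ hab]
  · funext a
    rw [end_mul_apply]
    by_cases ha : a ∈ P.part x
    · rw [e'_apply a, if_pos ha, e'_apply, if_pos ha]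
    · rw [e'_apply a, if_neg ha, e'_apply, if_neg (hnx a), hee]
  · intro c hc
    rw [mem_block (part_mem_parts _)]
    exact heT _ _ ((hmem c).1 hc)

/-! ### Saving generators by reversing arcs -/

/-- The product around the 3-cycle sends x and y to z, and z to x; its square fixes x and z and
sends y to x. -/
lemma collapse_mem_of_cycle {x y z : X} (hxy : x ≠ y) (hyz : y ≠ z) (hzx : z ≠ x)
    (h1 : collapse x y ∈ K) (h2 : collapse y z ∈ K) (h3 : collapse z x ∈ K) :
    collapse y x ∈ K := by
  have hW := mul_mem h2 (mul_mem h3 h1)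
  have : collapse y x = (collapse y z * (collapse z x * collapse x y))
      * (collapse y z * (collapse z x * collapse x y)) := by
    funext a
    simp only [end_mul_apply, collapse_apply]
    grind
  rw [this]
  exact mul_mem hW hW

/-- The transitive tournament with the arc from the least to the greatest vertex reversed is
enough. -/
lemma collapse_mem_of_tournament {Z : Finset X} {κ : X → ℕ} (hκ : Set.InjOn κ Z)
    (hZ : 3 ≤ Z.card)
    (h : ∀ x ∈ Z, ∀ y ∈ Z, κ x < κ y →
      ¬ ((∀ z ∈ Z, κ x ≤ κ z) ∧ ∀ z ∈ Z, κ z ≤ κ y) → collapse x y ∈ K)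
    (h' : ∀ x ∈ Z, ∀ y ∈ Z, κ x < κ y → (∀ z ∈ Z, κ x ≤ κ z) → (∀ z ∈ Z, κ z ≤ κ y) →
      collapse y x ∈ K) :
    ∀ x ∈ Z, ∀ y ∈ Z, x ≠ y → collapse x y ∈ K := by
  have hne : Z.Nonempty := card_pos.1 (by omega)
  obtain ⟨m, hm, hmin⟩ := exists_min_image Z κ hne
  obtain ⟨M, hM, hmax⟩ := exists_max_image Z κ hne
  have hlt : ∀ x ∈ Z, ∀ y ∈ Z, x ≠ y → κ x ≤ κ y → κ x < κ y := fun x hx y hy hxy hle =>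
    lt_of_le_of_ne hle fun e => hxy (hκ hx hy e)
  have third : ∀ x y : X, ∃ b ∈ Z, b ≠ x ∧ b ≠ y := by
    intro x y
    have h1 : ({x, y} : Finset X).card < Z.card := by
      have := card_le_two (a := x) (b := y); omega
    obtain ⟨b, hb, hb'⟩ := exists_mem_notMem_of_card_lt_card h1
    rw [mem_insert, mem_singleton, not_or] at hb'
    exact ⟨b, hb, hb'⟩
  have hmM : m ≠ M := by
    rintro rfl
    obtain ⟨b, hb, hbm, -⟩ := third m m
    exact hbm (hκ hb hm (le_antisymm (hmax b hb) (hmin b hb)))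
  have back : collapse M m ∈ K :=
    h' m hm M hM (hlt m hm M hM hmM (hmin M hM)) hmin hmax
  have a1 : ∀ b ∈ Z, b ≠ m → b ≠ M → collapse m b ∈ K := by
    intro b hb hbm hbM
    refine h m hm b hb (hlt m hm b hb hbm.symm (hmin b hb)) fun hh => hbM ?_
    exact hκ hb hM (le_antisymm (hmax b hb) (hh.2 M hM))
  have a2 : ∀ b ∈ Z, b ≠ m → b ≠ M → collapse b M ∈ K := by
    intro b hb hbm hbM
    refine h b hb M hM (hlt b hb M hM hbM (hmax b hb)) fun hh => hbm ?_
    exact hκ hb hm (le_antisymm (hh.1 m hm) (hmin b hb))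
  have a3 : ∀ b ∈ Z, b ≠ m → b ≠ M → collapse b m ∈ K := fun b hb hbm hbM =>
    collapse_mem_of_cycle hbm.symm hbM hmM.symm (a1 b hb hbm hbM) (a2 b hb hbm hbM) back
  have a4 : ∀ b ∈ Z, b ≠ m → b ≠ M → collapse M b ∈ K := fun b hb hbm hbM =>
    collapse_mem_of_cycle hbM hmM.symm hbm.symm (a2 b hb hbm hbM) back (a1 b hb hbm hbM)
  have a5 : collapse m M ∈ K := by
    obtain ⟨b, hb, hbm, hbM⟩ := third m M
    exact collapse_mem_of_cycle hmM.symm hbm.symm hbM back (a1 b hb hbm hbM) (a2 b hb hbm hbM)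
  intro x hx y hy hxy
  by_cases hxm : x = m
  · subst hxm
    by_cases hyM : y = M
    · rw [hyM]; exact a5
    · exact a1 y hy hxy.symm hyM
  by_cases hxM : x = M
  · subst hxM
    by_cases hym : y = m
    · rw [hym]; exact back
    · exact a4 y hy hym hxy.symm
  by_cases hym : y = m
  · rw [hym]; exact a3 x hx hxm hxM
  by_cases hyM : y = M
  · rw [hyM]; exact a2 x hx hxm hxM
  have fwd : ∀ x ∈ Z, ∀ y ∈ Z, x ≠ m → y ≠ M → κ x < κ y → collapse x y ∈ K := by
    intro x hx y hy hxm hyM hlt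
    exact h x hx y hy hlt fun hh => hxm (hκ hx hm (le_antisymm (hh.1 m hm) (hmin x hx)))
  -- A backward arc between interior vertices reverses y → x in the 3-cycle y → x → m → y, whose
  -- other arcs are already available.
  rcases lt_or_gt_of_ne (fun e => hxy (hκ hx hy e)) with hl | hl
  · exact fwd x hx y hy hxm hyM hl
  · exact collapse_mem_of_cycle hxy.symm hxm (Ne.symm hym) (fwd y hy x hx hym hxM hl)
      (a3 x hx hxm hxM) (a1 y hy hym hyM)

/-- For two blocks of equal size at least two, one may use one bijection backwards and all others
forwards. -/
lemma moveBlock_mem_of_reference {C D : Finset X} (hdis : ∀ a ∈ D, a ∉ C)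
    (h2 : 2 ≤ C.card) {θ θ' : X → X} (m1 : ∀ c ∈ C, θ c ∈ D) (m2 : ∀ d ∈ D, θ' d ∈ C)
    (i1 : ∀ c ∈ C, θ' (θ c) = c) (i2 : ∀ d ∈ D, θ (θ' d) = d)
    (hback : moveBlock D θ' ∈ K)
    (hfwd : ∀ η : X → X, (∀ c ∈ C, η c ∈ D) → Set.InjOn η C → (∃ c ∈ C, η c ≠ θ c) →
      moveBlock C η ∈ K) :
    (∀ η : X → X, (∀ c ∈ C, η c ∈ D) → Set.InjOn η C → moveBlock C η ∈ K) ∧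
    (∀ η : X → X, (∀ d ∈ D, η d ∈ C) → Set.InjOn η D → moveBlock D η ∈ K) := by
  have hdis' : ∀ a ∈ C, a ∉ D := fun a h1 h2 => hdis a h2 h1
  -- If η differs from θ, so does θη'θ, and both are permitted forward moves. Alternating them with
  -- the backward move θ' gives η' on D and θ on C.
  have key : ∀ η η' : X → X, (∀ c ∈ C, η c ∈ D) → (∀ d ∈ D, η' d ∈ C) →
      (∀ c ∈ C, η' (η c) = c) → (∀ d ∈ D, η (η' d) = d) → (∃ c ∈ C, η c ≠ θ c) →
      moveBlock D η' ∈ K ∧ moveBlock C θ ∈ K := by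
    intro η η' hm hm' hi hi' hne
    have inj : Set.InjOn η C := fun a ha b hb hab => by rw [← hi a ha, hab, hi b hb]
    have k1 := hfwd η hm inj hne
    have k2 : moveBlock C (θ ∘ η' ∘ θ) ∈ K := by
      refine hfwd _ (fun c hc => m1 _ (hm' _ (m1 c hc))) ?_ ?_
      · intro a ha b hb hab
        simp only [Function.comp_apply] at hab
        have h3 := congrArg θ' hab
        rw [i1 _ (hm' _ (m1 a ha)), i1 _ (hm' _ (m1 b hb))] at h3
        have h4 := congrArg η h3
        rw [hi' _ (m1 a ha), hi' _ (m1 b hb)] at h4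
        rw [← i1 a ha, h4, i1 b hb]
      · by_contra! hall
        obtain ⟨c, hc, hcne⟩ := hne
        apply hcne
        have h3 := congrArg θ' (hall c hc)
        simp only [Function.comp_apply] at h3
        rw [i1 _ (hm' _ (m1 c hc)), i1 c hc] at h3
        rw [← h3, hi' _ (m1 c hc), h3]
    constructor
    · have : moveBlock D η' = moveBlock D θ' * (moveBlock C (θ ∘ η' ∘ θ) *
          (moveBlock D θ' * moveBlock C η)) := by
        funext a
        simp only [end_mul_apply]
        by_cases ha : a ∈ C
        · rw [moveBlock_of_mem η ha, moveBlock_of_mem θ' (hm a ha),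
            moveBlock_of_mem _ (m2 _ (hm a ha)), Function.comp_apply, Function.comp_apply,
            i2 _ (hm a ha), hi a ha, moveBlock_of_mem _ (m1 a ha), i1 a ha,
            moveBlock_of_notMem _ (hdis' a ha)]
        by_cases hb : a ∈ D
        · rw [moveBlock_of_notMem η ha, moveBlock_of_mem θ' hb, moveBlock_of_mem _ (m2 a hb),
            Function.comp_apply, Function.comp_apply, i2 a hb,
            moveBlock_of_mem _ (m1 _ (hm' a hb)), i1 _ (hm' a hb), moveBlock_of_mem _ hb]
        · simp only [moveBlock_of_notMem _ ha, moveBlock_of_notMem _ hb]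
      rw [this]
      exact mul_mem hback (mul_mem k2 (mul_mem hback k1))
    · have : moveBlock C θ = moveBlock C (θ ∘ η' ∘ θ) * (moveBlock D θ' *
          (moveBlock C η * moveBlock D θ')) := by
        funext a
        simp only [end_mul_apply]
        by_cases ha : a ∈ C
        · rw [moveBlock_of_notMem θ' (hdis' a ha), moveBlock_of_mem η ha,
            moveBlock_of_mem θ' (hm a ha),
            moveBlock_of_mem _ (m2 _ (hm a ha)), Function.comp_apply, Function.comp_apply,
            i2 _ (hm a ha), hi a ha, moveBlock_of_mem _ ha]
        by_cases hb : a ∈ D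
        · have h3 := m2 a hb
          rw [moveBlock_of_mem θ' hb, moveBlock_of_mem η h3, moveBlock_of_mem _ (hm _ h3),
            moveBlock_of_mem _ (m2 _ (hm _ h3)), Function.comp_apply, Function.comp_apply,
            i2 _ (hm _ h3), hi _ h3, i2 a hb, moveBlock_of_notMem _ ha]
        · simp only [moveBlock_of_notMem _ ha, moveBlock_of_notMem _ hb]
      rw [this]
      exact mul_mem k2 (mul_mem hback (mul_mem k1 hback))
  -- Two points in C supply a bijection other than θ, by a transposition.
  have hθ : moveBlock C θ ∈ K := by
    obtain ⟨a, ha, b, hb, hab⟩ := one_lt_card.1 h2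
    have hsw : ∀ c ∈ C, Equiv.swap a b c ∈ C := by
      intro c hc
      rw [Equiv.swap_apply_def]
      split_ifs <;> assumption
    refine (key (θ ∘ Equiv.swap a b) (Equiv.swap a b ∘ θ') (fun c hc => m1 _ (hsw c hc))
      (fun d hd => hsw _ (m2 d hd)) ?_ ?_ ⟨a, ha, ?_⟩).2
    · intro c hc
      simp only [Function.comp_apply]
      rw [i1 _ (hsw c hc), Equiv.swap_apply_self]
    · intro d hd
      simp only [Function.comp_apply]
      rw [Equiv.swap_apply_self, i2 d hd]
    · simp only [Function.comp_apply, Equiv.swap_apply_left]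
      intro h
      apply hab
      rw [← i1 a ha, ← h, i1 b hb]
  constructor
  · intro η hη hi
    by_cases hne : ∃ c ∈ C, η c ≠ θ c
    · exact hfwd η hη hi hne
    · push Not at hne
      rwa [moveBlock_congr hne]
  · intro η' hη' hi'
    have hcard : C.card ≤ D.card :=
      card_le_card_of_injOn θ m1 fun a ha b hb hab => by rw [← i1 a ha, hab, i1 b hb]
    have hsurj := Finset.surjOn_of_injOn_of_card_le η' hη' hi' hcard
    have hinv : ∀ c ∈ C, ∃ d ∈ D, η' d = c := fun c hc => hsurj hc
    choose! η hη hηinv using hinv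
    by_cases hne : ∃ c ∈ C, η c ≠ θ c
    · refine (key η η' hη hη' hηinv (fun d hd => ?_) hne).1
      exact hi' (hη _ (hη' d hd)) hd (hηinv _ (hη' d hd))
    · push Not at hne
      rw [moveBlock_congr (η := θ')]
      · exact hback
      · intro d hd
        have h3 := hne _ (m2 d hd)
        rw [i2 d hd] at h3
        rw [← hηinv _ (m2 d hd), h3]

end Generate

end PartitionRank

/-! ### A smallest generating set -/

namespace PartitionRank

open Finset

variable {X : Type*} [Fintype X] [DecidableEq X] (P : Finpartition (Finset.univ : Finset X))

open Classical in
/-- The generator attached to a pair of points of one block. -/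
noncomputable def pairGen (κ : X → ℕ) (C : Finset X) (x y : X) : Function.End X :=
  if 3 ≤ C.card ∧ (∀ z ∈ C, κ x ≤ κ z) ∧ ∀ z ∈ C, κ z ≤ κ y then collapse y x else collapse x y

/-- The embedding `η` is the one bijection between two blocks that is used backwards. -/
def IsReversed (r : Finset X → ℕ) {C D : Finset X} (η : C ↪ D) : Prop :=
  (∃ h : C.card = D.card, η = (Finset.equivOfCardEq h).toEmbedding) ∧
    (C.card = 1 → 3 ≤ P.blockCount 1 ∧ ∀ B ∈ P.parts, B.card = 1 → r C ≤ r B ∧ r B ≤ r D)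

open Classical in
/-- The generator attached to an embedding of a block into another block. -/
noncomputable def embGen (r : Finset X → ℕ) {C D : Finset X} (η : C ↪ D) : Function.End X :=
  if h : IsReversed P r η then
    moveBlock D (extendEmb (Finset.equivOfCardEq h.1.choose).symm.toEmbedding)
  else moveBlock C (extendEmb η)

variable {P}

lemma exists_sizeGen (i : SizeIndex P) : ∃ D ∈ P.parts, D.card = i.2.1 ∧
    ∃ σ : X → X, i.1.1.image σ = D := by
  obtain ⟨⟨C, hC⟩, ⟨j, hj⟩⟩ := i
  obtain ⟨hj1, D, hD, rfl⟩ := mem_filter.1 hj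
  exact ⟨D, hD, rfl, exists_image_eq (P.nonempty_of_mem_parts hD) (mem_Ico.1 hj1).2.le⟩

/-- The generator attached to a block and a smaller block size. -/
noncomputable def sizeGen (i : SizeIndex P) : Function.End X :=
  moveBlock i.1.1 (exists_sizeGen i).choose_spec.2.2.choose

/-- The generators of a smallest generating set. -/
noncomputable def generator {κ : X → ℕ} {r : Finset X → ℕ} : GenIndex P κ r → Function.End X
  | Sum.inl ⟨C, p⟩ => pairGen κ C.1 p.1.1 p.1.2
  | Sum.inr (Sum.inl ⟨_, ⟨_, η⟩⟩) => embGen P r η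
  | Sum.inr (Sum.inr i) => sizeGen i

variable {κ : X → ℕ} {r : Finset X → ℕ}

lemma generator_mem (i : GenIndex P κ r) : generator i ∈ idempotentSet P := by
  rcases i with ⟨⟨C, hC⟩, ⟨⟨x, y⟩, hp⟩⟩ | ⟨⟨C, hC⟩, ⟨⟨D, hD⟩, η⟩⟩ | i
  · have hp1 := (mem_offDiag.1 (mem_filter.1 hp).1)
    have hxy : P.part x = P.part y := by rw [(mem_block hC).1 hp1.1, (mem_block hC).1 hp1.2.1]
    simp only [generator, pairGen]
    split_ifs
    · exact collapse_mem hxy.symm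
    · exact collapse_mem hxy
  · have hD1 := mem_filter.1 hD
    have hCD : C ≠ D := by rintro rfl; exact lt_irrefl _ hD1.2
    simp only [generator, embGen]
    split_ifs
    · exact moveBlock_mem hD1.1 hC hCD.symm fun c hc => extendEmb_mem _ hc
    · exact moveBlock_mem hC hD1.1 hCD fun c hc => extendEmb_mem _ hc
  · have hs := (exists_sizeGen i).choose_spec
    have hσ := hs.2.2.choose_spec
    refine moveBlock_mem i.1.2 hs.1 ?_ fun c hc => ?_
    · intro h
      have h1 := (mem_Ico.1 (mem_filter.1 i.2.2).1).2
      rw [← hs.2.1, ← h] at h1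
      exact lt_irrefl _ h1
    · have := mem_image_of_mem hs.2.2.choose hc
      rwa [hσ] at this

/-- The embedding of finsets given by a map. -/
def embOfInjOn {C D : Finset X} (η : X → X) (hm : ∀ c ∈ C, η c ∈ D) (hi : Set.InjOn η C) :
    C ↪ D :=
  ⟨fun c => ⟨η c, hm c c.2⟩, fun a b h => Subtype.ext (hi a.2 b.2 (congrArg Subtype.val h))⟩

lemma moveBlock_embOfInjOn {C D : Finset X} (η : X → X) (hm : ∀ c ∈ C, η c ∈ D)
    (hi : Set.InjOn η C) : moveBlock C (extendEmb (embOfInjOn η hm hi)) = moveBlock C η :=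
  moveBlock_congr fun a ha => by rw [extendEmb_of_mem _ ha]; rfl

section Generate

variable {K : Submonoid (Function.End X)}

/-- A two-point block has both collapses as generators; a larger block has the tournament with its
extreme arc reversed. -/
lemma pair_generators_mem (hκ : Function.Injective κ)
    (hgen : ∀ i : GenIndex P κ r, generator i ∈ K) :
    ∀ x y, x ≠ y → P.part x = P.part y → collapse x y ∈ K := by
  intro x y hxy hp
  have hgen' : ∀ C ∈ P.parts, ∀ x ∈ C, ∀ y ∈ C, x ≠ y → (C.card = 2 ∨ κ x < κ y) →
      pairGen κ C x y ∈ K := fun C hC x hx y hy hxy h =>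
    hgen (Sum.inl ⟨⟨C, hC⟩, ⟨(x, y), mem_filter.2 ⟨mem_offDiag.2 ⟨hx, hy, hxy⟩, h⟩⟩⟩)
  have hC := part_mem_parts (P := P) x
  have hx := mem_part_univ (P := P) x
  have hy : y ∈ P.part x := hp ▸ mem_part_univ y
  generalize P.part x = C at hC hx hy
  have h2 : 2 ≤ C.card := one_lt_card.2 ⟨x, hx, y, hy, hxy⟩
  rcases h2.eq_or_lt with h2 | h3
  · have := hgen' C hC x hx y hy hxy (Or.inl h2.symm)
    rwa [pairGen, if_neg (by omega)] at this
  · refine collapse_mem_of_tournament hκ.injOn h3 ?_ ?_ x hx y hy hxy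
    · intro a ha b hb hab hn
      have := hgen' C hC a ha b hb (by rintro rfl; omega) (Or.inr hab)
      rwa [pairGen, if_neg fun h => hn h.2] at this
    · intro a ha b hb hab h1 h2
      have := hgen' C hC a ha b hb (by rintro rfl; omega) (Or.inr hab)
      rwa [pairGen, if_pos ⟨h3, h1, h2⟩] at this

lemma embGen_mem (hgen : ∀ i : GenIndex P κ r, generator i ∈ K) {C D : Finset X}
    (hC : C ∈ P.parts) (hD : D ∈ P.parts) (hlt : r C < r D) (η : C ↪ D) : embGen P r η ∈ K :=
  hgen (Sum.inr (Sum.inl ⟨⟨C, hC⟩, ⟨⟨D, mem_filter.2 ⟨hD, hlt⟩⟩, η⟩⟩))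

lemma embGen_of_not_isReversed {C D : Finset X} {η : C ↪ D} (h : ¬ IsReversed P r η) :
    embGen P r η = moveBlock C (extendEmb η) := by
  rw [embGen, dif_neg h]

lemma singleton_mem_parts {x : X} : ({x} : Finset X) ∈ P.parts ↔ P.part x = {x} :=
  ⟨fun h => (mem_block h).1 (mem_singleton_self x), fun h => h ▸ part_mem_parts x⟩

lemma card_singletons :
    (univ.filter fun x : X => ({x} : Finset X) ∈ P.parts).card = P.blockCount 1 := by
  rw [Finpartition.blockCount]
  refine card_bij (fun x _ => {x}) ?_ ?_ ?_
  · intro x hx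
    exact mem_filter.2 ⟨(mem_filter.1 hx).2, card_singleton x⟩
  · intro x _ y _ h
    exact singleton_injective h
  · intro C hC
    obtain ⟨hC, h1⟩ := mem_filter.1 hC
    obtain ⟨x, rfl⟩ := card_eq_one.1 h1
    exact ⟨x, mem_filter.2 ⟨mem_univ _, hC⟩, rfl⟩

lemma singleton_generators_mem (hr : Function.Injective r)
    (hgen : ∀ i : GenIndex P κ r, generator i ∈ K)
    (htwo : P.blockCount 1 = 2 → ∀ c d, {c} ∈ P.parts → {d} ∈ P.parts → c ≠ d → collapse c d ∈ K) :
    ∀ c d, {c} ∈ P.parts → {d} ∈ P.parts → c ≠ d → collapse c d ∈ K := by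
  intro c d hc hd hcd
  set Z := univ.filter fun x : X => ({x} : Finset X) ∈ P.parts with hZ
  have hmem : ∀ x, x ∈ Z ↔ {x} ∈ P.parts := fun x => by simp [hZ]
  have hcard : Z.card = P.blockCount 1 := card_singletons
  have h2 : 2 ≤ Z.card :=
    one_lt_card.2 ⟨c, (hmem c).2 hc, d, (hmem d).2 hd, hcd⟩
  rcases h2.eq_or_lt with h2 | h3
  · exact htwo (by omega) c d hc hd hcd
  have hinj : Function.Injective fun x : X => r {x} := fun x y h => singleton_injective (hr h)
  let η : ∀ x y : X, ({x} : Finset X) ↪ ({y} : Finset X) := fun x y =>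
    ⟨fun _ => ⟨y, mem_singleton_self y⟩, fun a b _ => Subsingleton.elim a b⟩
  have hrev : ∀ x y : X, IsReversed P r (η x y) ↔
      (∀ z ∈ Z, r {x} ≤ r {z}) ∧ ∀ z ∈ Z, r {z} ≤ r {y} := by
    intro x y
    constructor
    · intro h
      have h4 := (h.2 (card_singleton x)).2
      exact ⟨fun z hz => (h4 {z} ((hmem z).1 hz) (card_singleton z)).1,
        fun z hz => (h4 {z} ((hmem z).1 hz) (card_singleton z)).2⟩
    · intro h
      refine ⟨⟨by simp, ?_⟩, fun _ => ⟨by omega, ?_⟩⟩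
      · ext a
        exact congrArg Subtype.val (Subsingleton.elim _ _)
      · intro B hB hB1
        obtain ⟨z, rfl⟩ := card_eq_one.1 hB1
        exact ⟨h.1 z ((hmem z).2 hB), h.2 z ((hmem z).2 hB)⟩
  refine collapse_mem_of_tournament hinj.injOn h3 ?_ ?_ c ((hmem c).2 hc) d ((hmem d).2 hd) hcd
  · intro x hx y hy hlt hn
    have := embGen_mem hgen ((hmem x).1 hx) ((hmem y).1 hy) hlt (η x y)
    rwa [embGen_of_not_isReversed (fun h => hn ((hrev x y).1 h)), collapse_eq_moveBlock] at this
  · intro x hx y hy hlt h1 h2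
    have := embGen_mem hgen ((hmem x).1 hx) ((hmem y).1 hy) hlt (η x y)
    rwa [embGen, dif_pos ((hrev x y).2 ⟨h1, h2⟩), collapse_eq_moveBlock] at this

lemma emb_generators_mem (hr : Function.Injective r)
    (hlt : ∀ C D : Finset X, C.card < D.card → r C < r D)
    (hgen : ∀ i : GenIndex P κ r, generator i ∈ K)
    (hone : ∀ c d, {c} ∈ P.parts → {d} ∈ P.parts → c ≠ d → collapse c d ∈ K)
    (hle : ∀ C ∈ P.parts, ∀ D ∈ P.parts, C ≠ D → C.card = D.card → r C < r D → 2 ≤ C.card →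
      (∀ η : X → X, (∀ c ∈ C, η c ∈ D) → Set.InjOn η C → moveBlock C η ∈ K) ∧
      (∀ η : X → X, (∀ d ∈ D, η d ∈ C) → Set.InjOn η D → moveBlock D η ∈ K)) :
    ∀ C ∈ P.parts, ∀ D ∈ P.parts, C ≠ D → ∀ η : X → X, (∀ c ∈ C, η c ∈ D) →
      Set.InjOn η C → moveBlock C η ∈ K := by
  intro C hC D hD hCD η hm hi
  rcases (card_le_card_of_injOn η hm hi).lt_or_eq with h | h
  · have := embGen_mem hgen hC hD (hlt _ _ h) (embOfInjOn η hm hi)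
    rwa [embGen_of_not_isReversed (by rintro ⟨⟨h1, -⟩, -⟩; omega), moveBlock_embOfInjOn] at this
  · have hpos := (P.nonempty_of_mem_parts hC).card_pos
    rcases (show 1 ≤ C.card from hpos).eq_or_lt with h1 | h2
    · obtain ⟨c, rfl⟩ := card_eq_one.1 h1.symm
      obtain ⟨d, rfl⟩ := card_eq_one.1 (h ▸ h1.symm)
      rw [← moveBlock_embOfInjOn η hm hi, collapse_eq_moveBlock]
      exact hone c d hC hD fun h => hCD (by rw [h])
    · rcases lt_or_gt_of_ne (fun e => hCD (hr e)) with hl | hl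
      · exact (hle C hC D hD hCD h hl h2).1 η hm hi
      · exact (hle D hD C hC hCD.symm h.symm hl (h ▸ h2)).2 η hm hi

/-- The reference bijection is the one from `Finset.equivOfCardEq`, exactly the embedding that
`IsReversed` singles out for blocks of at least two points. -/
lemma equal_size_generators_mem (hgen : ∀ i : GenIndex P κ r, generator i ∈ K)
    {C D : Finset X} (hC : C ∈ P.parts) (hD : D ∈ P.parts) (hCD : C ≠ D)
    (hcard : C.card = D.card) (hr : r C < r D) (h2 : 2 ≤ C.card) :
    (∀ η : X → X, (∀ c ∈ C, η c ∈ D) → Set.InjOn η C → moveBlock C η ∈ K) ∧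
      (∀ η : X → X, (∀ d ∈ D, η d ∈ C) → Set.InjOn η D → moveBlock D η ∈ K) := by
  let e := Finset.equivOfCardEq hcard
  refine moveBlock_mem_of_reference (θ := extendEmb e.toEmbedding)
    (θ' := extendEmb e.symm.toEmbedding) (fun a => not_mem_of_mem_of_ne hC hD hCD) h2
    (fun d hd => extendEmb_mem _ hd) (fun d hd => extendEmb_mem _ hd) ?_ ?_ ?_ ?_
  · intro d hd
    rw [extendEmb_of_mem _ hd, extendEmb_of_mem _ (Subtype.prop _)]
    simp
  · intro d hd
    rw [extendEmb_of_mem e.symm.toEmbedding hd, extendEmb_of_mem _ (Subtype.prop _)]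
    simp
  · have hrev : IsReversed P r e.toEmbedding := ⟨⟨hcard, rfl⟩, fun h => by omega⟩
    have := embGen_mem hgen hC hD hr e.toEmbedding
    rwa [embGen, dif_pos hrev] at this
  · intro η hm hi ⟨c, hc, hne⟩
    have := embGen_mem hgen hC hD hr (embOfInjOn η hm hi)
    rwa [embGen_of_not_isReversed, moveBlock_embOfInjOn] at this
    rintro ⟨⟨h1, h3⟩, -⟩
    apply hne
    rw [extendEmb_of_mem _ hc, ← h3]
    rfl

lemma idempotentSubmonoid_le_of_generators (hκ : Function.Injective κ)
    (hr : Function.Injective r) (hlt : ∀ C D : Finset X, C.card < D.card → r C < r D)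
    (hgen : ∀ i : GenIndex P κ r, generator i ∈ K)
    (htwo : P.blockCount 1 = 2 → ∀ c d, {c} ∈ P.parts → {d} ∈ P.parts → c ≠ d → collapse c d ∈ K) :
    idempotentSubmonoid P ≤ K := by
  refine idempotentSubmonoid_le_of_forall (pair_generators_mem hκ hgen)
    (emb_generators_mem hr hlt hgen (singleton_generators_mem hr hgen htwo)
      fun C hC D hD hCD hcard hr h2 => equal_size_generators_mem hgen hC hD hCD hcard hr h2) ?_
  intro C hC D hD hl
  let i : SizeIndex P := ⟨⟨C, hC⟩, ⟨D.card, mem_filter.2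
    ⟨mem_Ico.2 ⟨(P.nonempty_of_mem_parts hD).card_pos, hl⟩, D, hD, rfl⟩⟩⟩
  have hs := (exists_sizeGen i).choose_spec
  exact ⟨_, hs.1, hs.2.1, _, hs.2.2.choose_spec, hgen (Sum.inr (Sum.inr i))⟩

end Generate

lemma closure_range_generator (hκ : Function.Injective κ) (hr : Function.Injective r)
    (hlt : ∀ C D : Finset X, C.card < D.card → r C < r D) (h2 : P.blockCount 1 ≠ 2) :
    Submonoid.closure (Set.range (generator : GenIndex P κ r → _)) = idempotentSubmonoid P := by
  apply le_antisymm
  · exact Submonoid.closure_mono (Set.range_subset_iff.2 generator_mem)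
  · exact idempotentSubmonoid_le_of_generators hκ hr hlt
      (fun i => Submonoid.subset_closure ⟨i, rfl⟩) fun h => absurd h h2

lemma encard_range_le {ι α : Type*} [Fintype ι] (f : ι → α) :
    (Set.range f).encard ≤ Fintype.card ι := by
  rw [← Set.image_univ]
  refine (Set.encard_image_le _ _).trans ?_
  rw [Set.encard_univ, ENat.card_eq_coe_fintype_card]

lemma exists_two_singletons (hr : Function.Injective r) (h2 : P.blockCount 1 = 2) :
    ∃ c d : X, c ≠ d ∧ {c} ∈ P.parts ∧ {d} ∈ P.parts ∧ r {c} < r {d} ∧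
      ∀ x, {x} ∈ P.parts → x = c ∨ x = d := by
  rw [← card_singletons] at h2
  obtain ⟨c, d, hcd, hset⟩ := card_eq_two.1 h2
  have hmem : ∀ x, {x} ∈ P.parts ↔ x = c ∨ x = d := by
    intro x
    have := Finset.ext_iff.1 hset x
    simpa using this
  rcases lt_or_gt_of_ne (fun e => hcd (singleton_injective (hr e))) with h | h
  · exact ⟨c, d, hcd, (hmem c).2 (Or.inl rfl), (hmem d).2 (Or.inr rfl), h, fun x => (hmem x).1⟩
  · exact ⟨d, c, hcd.symm, (hmem d).2 (Or.inr rfl), (hmem c).2 (Or.inl rfl), h,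
      fun x hx => ((hmem x).1 hx).symm⟩

lemma collapse_singleton_mem {c d : X} (hc : {c} ∈ P.parts) (hd : {d} ∈ P.parts) (hcd : c ≠ d) :
    collapse c d ∈ idempotentSet P := by
  let η : ({c} : Finset X) ↪ ({d} : Finset X) :=
    ⟨fun _ => ⟨d, mem_singleton_self d⟩, fun a b _ => Subsingleton.elim a b⟩
  rw [← collapse_eq_moveBlock η]
  exact moveBlock_mem hc hd (fun h => hcd (singleton_injective h)) fun c hc => extendEmb_mem η hc

/-- The index of the pair of singleton blocks `{c}`, `{d}`. -/
def singletonIndex {c d : X} (hc : {c} ∈ P.parts) (hd : {d} ∈ P.parts) (h : r {c} < r {d}) :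
    GenIndex P κ r :=
  Sum.inr (Sum.inl ⟨⟨{c}, hc⟩, ⟨⟨{d}, mem_filter.2 ⟨hd, h⟩⟩,
    ⟨fun _ => ⟨d, mem_singleton_self d⟩, fun a b _ => Subsingleton.elim a b⟩⟩⟩)

lemma generator_singletonIndex {c d : X} (hc : {c} ∈ P.parts) (hd : {d} ∈ P.parts)
    (h : r {c} < r {d}) (h2 : P.blockCount 1 = 2) :
    generator (singletonIndex (κ := κ) hc hd h) = collapse c d := by
  simp only [singletonIndex, generator]
  rw [embGen_of_not_isReversed, collapse_eq_moveBlock]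
  intro h
  have := (h.2 (card_singleton c)).1
  omega

lemma closure_insert_range_generator (hκ : Function.Injective κ) (hr : Function.Injective r)
    (hlt : ∀ C D : Finset X, C.card < D.card → r C < r D) (h2 : P.blockCount 1 = 2) :
    ∃ e ∈ idempotentSet P,
      Submonoid.closure (insert e (Set.range (generator : GenIndex P κ r → _)))
        = idempotentSubmonoid P := by
  obtain ⟨c, d, hcd, hc, hd, hr', honly⟩ := exists_two_singletons hr h2
  refine ⟨collapse d c, collapse_singleton_mem hd hc hcd.symm, le_antisymm ?_ ?_⟩
  · exact Submonoid.closure_mono (Set.insert_subset (collapse_singleton_mem hd hc hcd.symm)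
      (Set.range_subset_iff.2 generator_mem))
  · have hgen : ∀ i : GenIndex P κ r, generator i ∈
        Submonoid.closure (insert (collapse d c) (Set.range (generator : GenIndex P κ r → _))) :=
      fun i => Submonoid.subset_closure (Set.mem_insert_of_mem _ ⟨i, rfl⟩)
    refine idempotentSubmonoid_le_of_generators hκ hr hlt hgen fun _ x y hx hy hxy => ?_
    rcases honly x hx with rfl | rfl <;> rcases honly y hy with rfl | rfl
    · exact absurd rfl hxy
    · rw [← generator_singletonIndex (κ := κ) hc hd hr' h2]
      exact hgen _
    · exact Submonoid.subset_closure (Set.mem_insert _ _)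
    · exact absurd rfl hxy

/-- The missing collapse d ↦ c is merged into an existing generator, so the number of generators
does not grow; the new one is not idempotent. -/
lemma closure_range_of_two_singletons (hP : ¬ P.BlocksEqualSize) (hκ : Function.Injective κ)
    (hr : Function.Injective r)
    (hlt : ∀ C D : Finset X, C.card < D.card → r C < r D) (h2 : P.blockCount 1 = 2) :
    ∃ f : GenIndex P κ r → Function.End X,
      Submonoid.closure (Set.range f) = idempotentSubmonoid P := by
  classical
  obtain ⟨c, d, hcd, hc, hd, hr', honly⟩ := exists_two_singletons hr h2
  -- This is where unequal block sizes matter: a block larger than the singletons gives c somewhere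
  -- else to go.
  obtain ⟨B, hB, hB1⟩ : ∃ B ∈ P.parts, 1 < B.card := by
    by_contra! hall
    apply hP
    intro C hC D hD
    have := hall C hC
    have := hall D hD
    have := (P.nonempty_of_mem_parts hC).card_pos
    have := (P.nonempty_of_mem_parts hD).card_pos
    omega
  obtain ⟨x, hx⟩ := P.nonempty_of_mem_parts hB
  have hxc : x ≠ c := by
    rintro rfl
    have := ((mem_block hB).1 hx).symm.trans (singleton_mem_parts.1 hc)
    rw [this, card_singleton] at hB1
    exact lt_irrefl _ hB1
  have hxd : x ≠ d := by
    rintro rfl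
    have := ((mem_block hB).1 hx).symm.trans (singleton_mem_parts.1 hd)
    rw [this, card_singleton] at hB1
    exact lt_irrefl _ hB1
  let η : ({c} : Finset X) ↪ B := ⟨fun _ => ⟨x, hx⟩, fun a b _ => Subsingleton.elim a b⟩
  have hrB : r {c} < r B := hlt _ _ (by rwa [card_singleton])
  let i₁ : GenIndex P κ r := Sum.inr (Sum.inl ⟨⟨{c}, hc⟩, ⟨⟨B, mem_filter.2 ⟨hB, hrB⟩⟩, η⟩⟩)
  let i₀ : GenIndex P κ r := singletonIndex hc hd hr'
  have hne : i₀ ≠ i₁ := by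
    intro h
    simp only [i₀, i₁, singletonIndex, Sum.inr.injEq, Sum.inl.injEq, Sigma.mk.injEq, true_and,
      heq_eq_eq, Subtype.mk.injEq] at h
    rw [← h.1, card_singleton] at hB1
    exact lt_irrefl _ hB1
  have hgen₁ : generator i₁ = collapse c x := by
    simp only [i₁, generator]
    rw [embGen_of_not_isReversed]
    · funext a
      rw [moveBlock_apply, collapse_apply]
      by_cases ha : a = c
      · rw [if_pos (by rw [ha]; exact mem_singleton_self c), if_pos ha,
          extendEmb_of_mem η (by rw [ha]; exact mem_singleton_self c)]
        rfl
      · rw [if_neg (by rwa [mem_singleton]), if_neg ha]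
    · rintro ⟨⟨h, -⟩, -⟩
      rw [card_singleton] at h
      omega
  have hgen₀ : generator i₀ = collapse c d := generator_singletonIndex hc hd hr' h2
  -- The map g sends d to c and c to x. Composing it with c ↦ d on one side gives d ↦ c, and on the
  -- other side c ↦ x, the generator it replaces.
  set g : Function.End X := collapse d c * collapse c x with hg
  have hgE : g ∈ idempotentSubmonoid P := by
    refine mul_mem (Submonoid.subset_closure (collapse_singleton_mem hd hc hcd.symm)) ?_
    rw [← hgen₁]
    exact Submonoid.subset_closure (generator_mem _)
  refine ⟨Function.update generator i₁ g, le_antisymm ?_ ?_⟩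
  · refine Submonoid.closure_le.2 (Set.range_subset_iff.2 fun i => ?_)
    by_cases hi : i = i₁
    · rw [hi, Function.update_self]; exact hgE
    · rw [Function.update_of_ne hi]
      exact Submonoid.subset_closure (generator_mem i)
  · set K := Submonoid.closure (Set.range (Function.update generator i₁ g)) with hK
    have hKg : g ∈ K := Submonoid.subset_closure ⟨i₁, Function.update_self _ _ _⟩
    have hKi : ∀ i, i ≠ i₁ → generator i ∈ K := fun i hi =>
      Submonoid.subset_closure ⟨i, Function.update_of_ne hi _ _⟩
    have hcdK : collapse c d ∈ K := hgen₀ ▸ hKi i₀ hne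
    have hdcK : collapse d c ∈ K := by
      have : collapse d c = g * collapse c d := by
        funext a
        simp only [hg, end_mul_apply, collapse_apply]
        grind
      rw [this]
      exact mul_mem hKg hcdK
    have hi₁ : generator i₁ ∈ K := by
      have : collapse c x = collapse c d * g := by
        funext a
        simp only [hg, end_mul_apply, collapse_apply]
        grind
      rw [hgen₁, this]
      exact mul_mem hcdK hKg
    refine idempotentSubmonoid_le_of_generators (κ := κ) hκ hr hlt (fun i => ?_)
      fun _ a b ha hb hab => ?_
    · by_cases hi : i = i₁
      · rw [hi]; exact hi₁
      · exact hKi i hi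
    · rcases honly a ha with rfl | rfl <;> rcases honly b hb with rfl | rfl
      · exact absurd rfl hab
      · exact hcdK
      · exact hdcK
      · exact absurd rfl hab

/-! ### Transfer to the monoid `E(X, P)` -/

/-- The inclusion of `E(X, P)` into all maps. -/
def inclusion (P : Finpartition (Finset.univ : Finset X)) :
    P.idempotentGenerated →* Function.End X :=
  P.transformations.subtype.comp P.idempotentGenerated.subtype

lemma inclusion_injective : Function.Injective (inclusion P) :=
  Subtype.val_injective.comp Subtype.val_injective

lemma mrange_inclusion : MonoidHom.mrange (inclusion P) = idempotentSubmonoid P := by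
  rw [inclusion, MonoidHom.mrange_comp, Submonoid.mrange_subtype, Finpartition.idempotentGenerated,
    MonoidHom.map_mclosure, idempotentSubmonoid]
  congr 1
  ext f
  constructor
  · rintro ⟨e, he, rfl⟩
    exact ⟨e.2, congrArg Subtype.val he⟩
  · rintro ⟨h1, h2⟩
    exact ⟨⟨f, h1⟩, Subtype.ext h2, rfl⟩

lemma closure_image_inclusion {U : Set P.idempotentGenerated} (hU : Submonoid.closure U = ⊤) :
    Submonoid.closure (inclusion P '' U) = idempotentSubmonoid P := by
  rw [← MonoidHom.map_mclosure, hU, ← MonoidHom.mrange_eq_map, mrange_inclusion]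

lemma exists_image_inclusion {V : Set (Function.End X)}
    (hV : Submonoid.closure V = idempotentSubmonoid P) :
    ∃ U : Set P.idempotentGenerated, Submonoid.closure U = ⊤ ∧ inclusion P '' U = V := by
  have himg : inclusion P '' (inclusion P ⁻¹' V) = V := by
    rw [Set.image_preimage_eq_iff]
    intro f hf
    have : f ∈ MonoidHom.mrange (inclusion P) := by
      rw [mrange_inclusion, ← hV]
      exact Submonoid.subset_closure hf
    exact this
  refine ⟨inclusion P ⁻¹' V, ?_, himg⟩
  apply Submonoid.map_injective_of_injective (f := inclusion P) inclusion_injective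
  rw [MonoidHom.map_mclosure, himg, hV, ← MonoidHom.mrange_eq_map, mrange_inclusion]

lemma inclusion_mem_idempotentSet {u : P.idempotentGenerated} :
    inclusion P u ∈ idempotentSet P ↔ IsIdempotentElem u := by
  constructor
  · intro h
    apply inclusion_injective
    rw [map_mul]
    exact h.2
  · intro h
    refine ⟨u.1.2, ?_⟩
    rw [← map_mul]
    exact congrArg _ h

lemma le_monoidRank {n : ℕ∞} (h : ∀ V : Set (Function.End X),
    Submonoid.closure V = idempotentSubmonoid P → n ≤ V.encard) :
    n ≤ monoidRank P.idempotentGenerated := by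
  refine le_iInf₂ fun U hU => ?_
  rw [← inclusion_injective.encard_image U]
  exact h _ (closure_image_inclusion hU)

lemma monoidRank_le {V : Set (Function.End X)}
    (hV : Submonoid.closure V = idempotentSubmonoid P) :
    monoidRank P.idempotentGenerated ≤ V.encard := by
  obtain ⟨U, hU, rfl⟩ := exists_image_inclusion hV
  rw [inclusion_injective.encard_image U]
  exact iInf₂_le U hU

lemma le_monoidIdRank {n : ℕ∞} (h : ∀ V : Set (Function.End X), V ⊆ idempotentSet P →
    Submonoid.closure V = idempotentSubmonoid P → n ≤ V.encard) :
    n ≤ monoidIdRank P.idempotentGenerated := by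
  refine le_iInf₂ fun U hU => ?_
  rw [← inclusion_injective.encard_image U]
  refine h _ ?_ (closure_image_inclusion hU.2)
  rintro _ ⟨u, hu, rfl⟩
  exact inclusion_mem_idempotentSet.2 (hU.1 hu)

lemma monoidIdRank_le {V : Set (Function.End X)} (hid : V ⊆ idempotentSet P)
    (hV : Submonoid.closure V = idempotentSubmonoid P) :
    monoidIdRank P.idempotentGenerated ≤ V.encard := by
  obtain ⟨U, hU, rfl⟩ := exists_image_inclusion hV
  rw [inclusion_injective.encard_image U]
  exact iInf₂_le U ⟨fun u hu => inclusion_mem_idempotentSet.1 (hid ⟨u, hu, rfl⟩), hU⟩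

end PartitionRank

open PartitionRank in
theorem theorem3p15 {X : Type*} [Fintype X] [DecidableEq X]
    (P : Finpartition (Finset.univ : Finset X)) (hP : ¬ P.BlocksEqualSize) :
    monoidRank P.idempotentGenerated = P.rho ∧
    (P.blockCount 1 ≠ 2 → monoidIdRank P.idempotentGenerated = P.rho) ∧
    (P.blockCount 1 = 2 → monoidIdRank P.idempotentGenerated = P.rho + 1) := by
  let κ : X → ℕ := fun x => Fintype.equivFin X x
  have hκ : Function.Injective κ := Fin.val_injective.comp (Fintype.equivFin X).injective
  obtain ⟨r, hr, hlt⟩ := exists_rank_function X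
  have hcard := card_genIndex P κ hκ r hr hlt
  rw [← hcard]
  refine ⟨le_antisymm ?_ (le_monoidRank fun V hV => card_genIndex_le_encard hV), fun h2 => ?_,
    fun h2 => ?_⟩
  · by_cases h2 : P.blockCount 1 = 2
    · obtain ⟨f, hf⟩ := closure_range_of_two_singletons hP hκ hr hlt h2
      exact (monoidRank_le hf).trans (encard_range_le f)
    · exact (monoidRank_le (closure_range_generator hκ hr hlt h2)).trans (encard_range_le _)
  · refine le_antisymm ?_ (le_monoidIdRank fun V _ hV => card_genIndex_le_encard hV)
    exact (monoidIdRank_le (Set.range_subset_iff.2 generator_mem)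
      (closure_range_generator hκ hr hlt h2)).trans (encard_range_le _)
  · refine le_antisymm ?_
      (le_monoidIdRank fun V hid hV => card_genIndex_succ_le_encard hV hid hr h2)
    obtain ⟨e, he, hcl⟩ := closure_insert_range_generator (P := P) hκ hr hlt h2
    refine (monoidIdRank_le (Set.insert_subset he (Set.range_subset_iff.2 generator_mem))
      hcl).trans ((Set.encard_insert_le _ _).trans ?_)
    gcongr
    exact encard_range_le _
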